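/- **Setting.** Let $(Q',w)$ be a finite framed quiver without loops: finite sets $I$ of vertices and $E$ of edges, head and tail maps $h,t:E\to I$ with $h(a)\neq t(a)$ for all $a\in E$, and $w\in\mathbb Z_{\ge0}^{I}$. Let $Q$ be the unframed quiver obtained by adding a vertex $\infty$ and, for each $i\in I$, $w_i$ edges from $\infty$ to $i$; let $\tilde Q$ be obtained from $Q$ by adding for each edge $a$ a reversed edge $\bar a$. For $v\in\mathbb Z_{\ge0}^{I}$ put $V_i=\mathbb C^{v_i}$ $(i\in I)$, $V_\infty=\mathbb C$, $\operatorname{Rep}(\tilde Q,v)=\bigoplus_{a}\operatorname{Hom}(V_{t(a)},V_{h(a)})$ (sum over the edges of $\tilde Q$) with metric $\sum_a\operatorname{Re}\operatorname{Tr}(X_aY_a^*)$, and $G_v=\prod_{i\in I\cup\{\infty\}}GL(V_i)$ acting by $(g\cdot x)_a=g_{h(a)}x_ag_{t(a)}^{-1}$, with infinitesimal action $\rho_x^{\mathbb C}(u)=(u_{h(a)}x_a-x_au_{t(a)})_a$. Regarding the $x_a$ as endomorphisms of $\bigoplus_iV_i$, put $\mu_I(x)=\frac1{2i}\sum_{a\in\tilde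 Q}[x_a,x_a^*]$ and $\mu_{\mathbb C}(x)=\sum_{a\in Q}[x_a,x_{\bar a}]$. The canonical stability parameter is $\alpha=\alpha(Q,v)$ with $\alpha_i=1$ for $i\in I$ and $\alpha_\infty=-\sum_{j\in I}v_j$; the symbol $\alpha$ also denotes the central element $(i\alpha_j\operatorname{id}_{V_j})_j$. A point $x$ is *$\alpha$-semistable* if for every $\zeta\in\mathbb C\setminus\{0\}$ the closure of the orbit of $(x,\zeta)$ under $g\cdot(x,\zeta)=(g\cdot x,\prod_i\det(g_i)^{\alpha_i}\zeta)$ in $\operatorname{Rep}(\tilde Q,v)\times\mathbb C$ does not meet $\operatorname{Rep}(\tilde Q,v)\times\{0\}$; *polystable* if moreover these orbits are closed; and *stable* if moreover its isotropy group in $G_v$ consists of scalar multiples of the identity. Let $\mathcal M(Q,v)=\mu_{\mathbb C}^{-1}(0)^{\alpha\text{-st}}/G_v$ with the quotient topology. **Approximate flow lines.** Let $f=\frac12\|\mu_I-\alpha(Q,v)\|^2$ on $\operatorname{Rep}(\tilde Q,v)$, where $\|u\|^2=\operatorname{Tr}(uu^*)$. For $v_1\le v$ use the coordinate inclusions $\mathbb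 C^{(v_1)_i}\subseteq\mathbb C^{v_i}$, and for $x_1\in\operatorname{Rep}(\tilde Q,v_1)$ write $(x_1,0)\in\operatorname{Rep}(\tilde Q,v)$ for its extension by zero. Let $C^0_{v_1}$ be the set of critical points of $f$ in $\mu_{\mathbb C}^{-1}(0)$ of the form $(x_1,0)$ with $x_1$ an $\alpha(Q,v_1)$-stable representation of dimension $v_1$. For a critical point $x\in\mu_{\mathbb C}^{-1}(0)$ the negative slice $S_x^-$ is the set of $\delta x$ in the sum of the eigenspaces with negative eigenvalue of the Hessian of $f$ at $x$ such that $\delta x\perp\operatorname{im}\rho_x^{\mathbb C}$ and $\mu_{\mathbb C}(x+\delta x)=0$. For $v_1<v_2$, let $\mathcal{MF}(Q,v_1,v_2)\subseteq\mathcal M(Q,v_1)\times\mathcal M(Q,v_2)$ be the subspace of pairs which have representatives $x_1$, $x_2$ such that, with $v=v_2$ in the above, $(x_1,0)\in C^0_{v_1}$, $x_2\in C^0_{v_2}$, and $g\cdot((x_1,0)+\delta x)=x_2$ for some $\delta x\in S^-_{(x_1,0)}$ and $g\in G_{v_2}$. **Hecke correspondence.** Let $k\in I$ and $v_k>0$.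 Let $\mathcal B_k(Q,v)\subseteq\mathcal M(Q,v-e_k)\times\mathcal M(Q,v)$ be the subspace of pairs $([x_1],[x_2])$ for which there are representatives $x_1$, $x_2$ and a nonzero family of linear maps $\xi_i:V_i^{(1)}\to V_i^{(2)}$, $i\in I\cup\{\infty\}$, between the spaces of dimension vectors $v-e_k$ and $v$, with $\xi_\infty=\operatorname{id}$ and $\xi_{h(a)}(x_1)_a=(x_2)_a\xi_{t(a)}$ for all edges $a$ of $\tilde Q$. **Theorem.** For every finite framed quiver without loops, every $v\in\mathbb Z_{\ge0}^I$ and every $k\in I$ with $v_k>0$, there is a homeomorphism $$\mathcal{MF}(Q,v-e_k,v)\;\cong\;\mathcal B_k(Q,v)$$ (for the subspace topologies) which sends each pair of equivalence classes $([x_1],[x_2])$ to the same pair $([x_1],[x_2])$. -/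

import Mathlib

open scoped Matrix

noncomputable section

namespace FlowHecke

/-! ### Quivers and their representations -/

/-- A quiver with vertex set `I` and edge set `E`, given by its head and tail maps. -/
structure EdgeQuiver (I E : Type*) where
  head : E → I
  tail : E → I

/-- The doubled quiver: every edge `a` (kept as `Sum.inl a`) gets a new edge with the opposite
orientation (`Sum.inr a`). -/
def EdgeQuiver.double {I E : Type*} (Q : EdgeQuiver I E) : EdgeQuiver I (E ⊕ E) where
  head := Sum.elim Q.head Q.tail
  tail := Sum.elim Q.tail Q.head

section Reps

variable {I E : Type*} [Fintype E]

/-- Representations of `Q` on the spaces `V_i = ℂ ^ (v i)`, stored through the matrix entries of the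
homomorphisms `V_{t(a)} → V_{h(a)}`. As a Euclidean space it carries the metric
`g(X, Y) = ∑ₐ Re Tr (Xₐ Yₐ*)`. -/
abbrev Rep (Q : EdgeQuiver I E) (v : I → ℕ) : Type _ :=
  EuclideanSpace ℂ (Σ a : E, Fin (v (Q.head a)) × Fin (v (Q.tail a)))

variable {Q : EdgeQuiver I E} {v : I → ℕ}

/-- The matrix of a representation along an edge. -/
def mat (x : Rep Q v) (a : E) : Matrix (Fin (v (Q.head a))) (Fin (v (Q.tail a))) ℂ :=
  Matrix.of fun i j => x ⟨a, (i, j)⟩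

/-- The representation with prescribed matrices. -/
def ofMat (M : ∀ a : E, Matrix (Fin (v (Q.head a))) (Fin (v (Q.tail a))) ℂ) : Rep Q v :=
  WithLp.toLp 2 fun p => M p.1 p.2.1 p.2.2


/-- The group `G_v = ∏ᵢ GL(V_i)`. -/
abbrev Gauge (v : I → ℕ) : Type _ := ∀ i : I, GL (Fin (v i)) ℂ

/-- The action `(g · x)_a = g_{h(a)} x_a g_{t(a)}⁻¹`. -/
def act (g : Gauge v) (x : Rep Q v) : Rep Q v :=
  ofMat fun a => (g (Q.head a)).val * mat x a * (g (Q.tail a))⁻¹.val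

/-- The infinitesimal action `(ρ_x(u))_a = u_{h(a)} x_a - x_a u_{t(a)}` of the Lie algebra
`⨁ᵢ End(V_i)` of `G_v`. -/
def infAct (x : Rep Q v) (u : ∀ i : I, Matrix (Fin (v i)) (Fin (v i)) ℂ) : Rep Q v :=
  ofMat fun a => u (Q.head a) * mat x a - mat x a * u (Q.tail a)

theorem mat_ofMat (M : ∀ a : E, Matrix (Fin (v (Q.head a))) (Fin (v (Q.tail a))) ℂ) (a : E) :
    mat (ofMat M : Rep Q v) a = M a := rfl

theorem ofMat_mat (x : Rep Q v) : ofMat (mat x) = x := rfl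

theorem act_one (x : Rep Q v) : act (1 : Gauge v) x = x := by
  conv_rhs => rw [← ofMat_mat x]
  simp [act]

theorem act_mul (g h : Gauge v) (x : Rep Q v) : act (g * h) x = act g (act h x) := by
  simp only [act, mat_ofMat]
  congr 1
  funext a
  simp only [Pi.mul_apply, mul_inv_rev, Units.val_mul, Matrix.mul_assoc]

/-! ### Stability -/

section Stability

variable [Fintype I]

/-- The character `χ_α(g) = ∏ᵢ det(g_i) ^ α_i`. -/
def character (α : I → ℤ) (g : Gauge v) : ℂ := ∏ i, ((g i).val.det) ^ (α i)

/-- The orbit of `(x, ξ)` in the trivial line bundle `Rep(Q, v) × ℂ`, for the lift of the action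
given by `χ_α`. -/
def liftedOrbit (α : I → ℤ) (x : Rep Q v) (ξ : ℂ) : Set (Rep Q v × ℂ) :=
  Set.range fun g : Gauge v => (act g x, character α g * ξ)

/-- `α`-semistability: the closures of the lifted orbits avoid the zero section. -/
def IsSemistable (α : I → ℤ) (x : Rep Q v) : Prop :=
  ∀ ξ : ℂ, ξ ≠ 0 → closure (liftedOrbit α x ξ) ∩ {p | p.2 = 0} = ∅

/-- `α`-polystability: moreover the lifted orbits are closed. -/
def IsPolystable (α : I → ℤ) (x : Rep Q v) : Prop :=
  IsSemistable α x ∧ ∀ ξ : ℂ, ξ ≠ 0 → IsClosed (liftedOrbit α x ξ)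

/-- `α`-stability: moreover the isotropy group consists of the scalar multiples of the identity. -/
def IsStable (α : I → ℤ) (x : Rep Q v) : Prop :=
  IsPolystable α x ∧
    ∀ g : Gauge v, act g x = x → ∃ c : ℂ, ∀ i, (g i).val = c • (1 : Matrix _ _ ℂ)

end Stability

/-! ### Moment maps and the energy -/

section Moment

variable [Fintype I] [DecidableEq I]

/-- Index set of the standard basis of `Vect(Q, v) = ⨁ᵢ V_i`. -/
abbrev Tot (v : I → ℕ) : Type _ := Σ i : I, Fin (v i)

/-- The matrix of the inclusion `V_i ↪ Vect(Q, v)`. -/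
def blockIncl (v : I → ℕ) (i : I) : Matrix (Tot v) (Fin (v i)) ℂ :=
  Matrix.of fun p j => if p = ⟨i, j⟩ then 1 else 0

/-- The component `x_a` regarded as an endomorphism of `Vect(Q, v)`. -/
def toEnd (x : Rep Q v) (a : E) : Matrix (Tot v) (Tot v) ℂ :=
  blockIncl v (Q.head a) * mat x a * (blockIncl v (Q.tail a))ᵀ

/-- The moment map `μ(x) = (1 / 2i) ∑ₐ [x_a, x_a*]`. On the doubled quiver this is `μ_I`. -/
def momentMap (x : Rep Q v) : Matrix (Tot v) (Tot v) ℂ :=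
  (1 / (2 * Complex.I)) • ∑ a, (toEnd x a * (toEnd x a)ᴴ - (toEnd x a)ᴴ * toEnd x a)

/-- The central element `(i α_j · id_{V_j})_j` attached to a stability parameter. -/
def centralElement (v : I → ℕ) (α : I → ℤ) : Matrix (Tot v) (Tot v) ℂ :=
  Matrix.diagonal fun p => Complex.I * (α p.1 : ℂ)

/-- The function `f = ½ ‖μ - α‖²`, for the norm `‖u‖² = Tr (u u*)`. -/
def energy (α : I → ℤ) (x : Rep Q v) : ℝ :=
  (1 / 2) * ∑ p, ∑ q, ‖(momentMap x - centralElement v α) p q‖ ^ 2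

/-- Critical points of `‖μ - α‖²`. -/
def IsCritical (α : I → ℤ) (x : Rep Q v) : Prop := gradient (energy α) x = 0

/-- The Hessian `H_f(X) = ∇_X grad f` at `x`. -/
def hessian (α : I → ℤ) (x : Rep Q v) : Rep Q v →L[ℝ] Rep Q v :=
  fderiv ℝ (gradient (energy α)) x

/-- The negative eigenspace of the Hessian: the sum of the eigenspaces with eigenvalue `r < 0`. -/
def negEigenspace (α : I → ℤ) (x : Rep Q v) : Submodule ℝ (Rep Q v) :=
  ⨆ r ∈ Set.Iio (0 : ℝ), Module.End.eigenspace (hessian α x : Module.End ℝ (Rep Q v)) r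

/-- The complex moment map `μ_ℂ(A, B) = ∑ₐ [A_a, B_ā]` on representations of the doubled quiver. -/
def complexMoment (x : Rep Q.double v) : Matrix (Tot v) (Tot v) ℂ :=
  ∑ a : E, (toEnd x (Sum.inl a) * toEnd x (Sum.inr a) - toEnd x (Sum.inr a) * toEnd x (Sum.inl a))

/-- The slice `S_x = { δx ∈ ker (ρ_x^ℂ)* : x + δx ∈ μ_ℂ⁻¹(0) }`, where `ker (ρ_x^ℂ)*` is the
orthogonal complement of the image of the infinitesimal action. -/
def slice (x : Rep Q.double v) : Set (Rep Q.double v) :=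
  {δ | (∀ u : ∀ i : I, Matrix (Fin (v i)) (Fin (v i)) ℂ, inner ℝ (infAct x u) δ = 0) ∧
    complexMoment (x + δ) = 0}

/-- The negative slice: the part of the slice inside the negative eigenspace of the Hessian. -/
def negSlice (α : I → ℤ) (x : Rep Q.double v) : Set (Rep Q.double v) :=
  {δ | δ ∈ negEigenspace α x} ∩ slice x

end Moment

/-- The matrix of the coordinate inclusion `ℂ ^ m ↪ ℂ ^ n` onto the first `m` coordinates
(used for `m ≤ n`). -/
def coordIncl (m n : ℕ) : Matrix (Fin n) (Fin m) ℂ :=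
  Matrix.of fun i j => if (i : ℕ) = (j : ℕ) then 1 else 0

/-- For `v₁ ≤ v`, the representation `(x₁, 0)` on `Vect(Q, v)`: it is `x₁` on
`Vect(Q, v₁) ⊆ Vect(Q, v)` and zero on the orthogonal complement. -/
def extendZero {v₁ : I → ℕ} (v : I → ℕ) (x : Rep Q v₁) : Rep Q v :=
  ofMat fun a => coordIncl (v₁ (Q.head a)) (v (Q.head a)) * mat x a *
    (coordIncl (v₁ (Q.tail a)) (v (Q.tail a)))ᵀ

end Reps

/-! ### Framed quivers and quiver varieties -/

/-- A framed quiver: a quiver with vertices `I` and edges `E`, together with the dimension vector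
`w` of the framing. -/
structure FramedQuiver (I E : Type*) extends EdgeQuiver I E where
  w : I → ℕ

section Framed

variable {I E : Type*}

/-- The unframed quiver attached to a framed quiver: there is one extra vertex `∞ = none`, and
`w i` extra edges from `∞` to each vertex `i`. -/
def FramedQuiver.unframe (F : FramedQuiver I E) :
    EdgeQuiver (Option I) (E ⊕ Σ i : I, Fin (F.w i)) where
  head := Sum.elim (fun a => some (F.head a)) (fun b => some b.1)
  tail := Sum.elim (fun a => some (F.tail a)) (fun _ => none)

/-- The dimension vector on `I ∪ {∞}` with dimension `1` at `∞`. -/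
def dimVec (v : I → ℕ) : Option I → ℕ
  | none => 1
  | some i => v i

/-- The canonical stability parameter: `1` on `I` and `-∑ⱼ v_j` at `∞`. -/
def canonicalParam [Fintype I] (v : I → ℕ) : Option I → ℤ
  | none => -∑ j, (v j : ℤ)
  | some _ => 1

variable [Fintype I] [DecidableEq I] [Fintype E]

/-- Representations, with dimension vector `(v, 1)`, of the doubled unframed quiver. -/
abbrev FRep (F : FramedQuiver I E) (v : I → ℕ) : Type _ := Rep F.unframe.double (dimVec v)

/-- The stable points of `μ_ℂ⁻¹(0)`, for the canonical stability parameter. -/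
abbrev StablePoint (F : FramedQuiver I E) (v : I → ℕ) : Type _ :=
  {x : FRep F v // complexMoment x = 0 ∧ IsStable (canonicalParam v) x}

/-- Two stable points are equivalent if they lie in the same `G_v`-orbit. -/
def orbitSetoid (F : FramedQuiver I E) (v : I → ℕ) : Setoid (StablePoint F v) where
  r x y := ∃ g : Gauge (dimVec v), act g x.1 = y.1
  iseqv :=
    { refl := fun x => ⟨1, act_one x.1⟩
      symm := fun {x y} ⟨g, hg⟩ => ⟨g⁻¹, by rw [← hg, ← act_mul, inv_mul_cancel, act_one]⟩
      trans := fun {x y z} ⟨g, hg⟩ ⟨h, hh⟩ => ⟨h * g, by rw [act_mul, hg, hh]⟩ }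

/-- The quiver variety `M(Q, v)`: the space of `G_v`-orbits of stable points of `μ_ℂ⁻¹(0)`, with
the quotient topology. -/
abbrev QuiverVariety (F : FramedQuiver I E) (v : I → ℕ) : Type _ := Quotient (orbitSetoid F v)

/-! ### Approximate flow lines -/

/-- The set `C⁰_{v₁}` inside representations of dimension `v ≥ v₁`: critical points in `μ_ℂ⁻¹(0)` of
`‖μ_I - α(Q, v)‖²` of the form `(x₁, 0)` with `x₁` a stable representation of dimension `v₁`. -/
def critSetZero (F : FramedQuiver I E) (v₁ v : I → ℕ) : Set (FRep F v) :=
  {x | complexMoment x = 0 ∧ IsCritical (canonicalParam v) x ∧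
    ∃ x₁ : FRep F v₁, IsStable (canonicalParam v₁) x₁ ∧ x = extendZero (dimVec v) x₁}

/-- The space `C(Q, v₁, v₂, v)` of pairs of critical points in `C⁰_{v₁} × C⁰_{v₂}` joined by an
approximate flow line: some point `x + δx` of the negative slice at `x` is isomorphic to `y`. -/
def flowPairs (F : FramedQuiver I E) (v₁ v₂ v : I → ℕ) : Set (FRep F v × FRep F v) :=
  {p | p.1 ∈ critSetZero F v₁ v ∧ p.2 ∈ critSetZero F v₂ v ∧
    ∃ δ ∈ negSlice (canonicalParam v) p.1, ∃ g : Gauge (dimVec v), act g (p.1 + δ) = p.2}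

/-- The space `MF(Q, v₁, v₂)` of pairs of equivalence classes which have representatives
`x₁`, `x₂` with `((x₁, 0), x₂) ∈ C(Q, v₁, v₂, v₂)`. -/
def flowModuli (F : FramedQuiver I E) (v₁ v₂ : I → ℕ) :
    Set (QuiverVariety F v₁ × QuiverVariety F v₂) :=
  {p | ∃ (x₁ : StablePoint F v₁) (x₂ : StablePoint F v₂),
    (Quotient.mk (orbitSetoid F v₁) x₁, Quotient.mk (orbitSetoid F v₂) x₂) = p ∧
      (extendZero (dimVec v₂) x₁.1, x₂.1) ∈ flowPairs F v₁ v₂ v₂}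

/-! ### The Hecke correspondence -/

/-- The space `Hom⁰(Q, v₁, v₂)` of families of linear maps between the spaces at each vertex. -/
abbrev HomZero (v₁ v₂ : I → ℕ) : Type _ :=
  ∀ i : Option I, Matrix (Fin (dimVec v₂ i)) (Fin (dimVec v₁ i)) ℂ

/-- The Hecke correspondence `B_k(Q, v)`: pairs of classes intertwined by a nonzero `ξ` in
`Hom⁰(Q, v - e_k, v)` whose component at `∞` is the identity. -/
def heckeCorrespondence (F : FramedQuiver I E) (k : I) (v : I → ℕ) :
    Set (QuiverVariety F (v - Pi.single k 1) × QuiverVariety F v) :=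
  {p | ∃ (x₁ : StablePoint F (v - Pi.single k 1)) (x₂ : StablePoint F v),
    (Quotient.mk (orbitSetoid F (v - Pi.single k 1)) x₁, Quotient.mk (orbitSetoid F v) x₂) = p ∧
      ∃ ξ : HomZero (v - Pi.single k 1) v, ξ ≠ 0 ∧ ξ none = (1 : Matrix (Fin 1) (Fin 1) ℂ) ∧
        ∀ a, ξ (F.unframe.double.head a) * mat x₁.1 a = mat x₂.1 a * ξ (F.unframe.double.tail a)}

end Framed

end FlowHecke

end

/-!
# The Hecke correspondence as a space of approximate flow lines

Both spaces are subsets of the same product of quiver varieties, so the claim is that they are equal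
as sets.

Write `H(x)_i = ∑ₐ [x_a, x_a*]_i + 2 α_i` (`shiftedMoment`), which is `2i (μ - α)`. The energy is
`⅛ ∑ ‖H_i‖²`, its gradient at `x` is half the infinitesimal action of `H(x)` on `x`
(`gradient_energy`), and on the orthogonal complement of the image of the infinitesimal action the
Hessian is half the commutator with `H(x)` (`hessian_apply`, `bracket_eq_zero`). At a critical point
`(x₁, 0)` with `x₁` stable of dimension `v - e_k`, the matrix `H` commutes with `x₁`, hence is a scalar
on its support; taking traces, this scalar is negative (`exists_shiftedMoment_eq_neg`), while `H = 2` on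
the complementary line. So the negative directions orthogonal to the orbit are exactly those that
map the complementary line into the support of `x₁`
(`mat_mul_eq_zero_of_mem_negEigenspace`, `mem_negEigenspace`).

*Flow lines give Hecke modifications.* If `δ` is in the negative slice, then `(x₁, 0) + δ` restricts
to `x₁` on the support of `x₁`, so the inclusion followed by an isomorphism `(x₁, 0) + δ ≅ x₂`
intertwines `x₁` and `x₂`; a scalar normalizes it at `∞`.

*Hecke modifications give flow lines.* Stability for the canonical parameter implies that no nonzero
subrepresentation vanishes at `∞` (`isCostable_of_isSemistable`), so the intertwiner is injective.
Moreover the orbit of each such representation contains solutions of `∑ₐ [x_a, x_a*] = -α / c` for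
every `c > 0` (`IsCostable.exists_balanced`, the Kempf–Ness argument); the right constants make
`(x₁, 0)` and `x₂` critical. Extending the intertwiner to an automorphism makes `x₂` block triangular,
and its quotient block vanishes because the quiver has no loops. What remains is a map `b` from the
complementary line to the support of `x₁`, which a unipotent change of basis makes orthogonal to the
orbit (`exists_act_eq_add_of_block`).

For the Kempf–Ness argument, compositions of the maps of the representation along paths ending at `∞`
give, on a costable representation, invertible frames `P_i` of the spaces `V_i`
(`IsCostable.exists_frames`). The product of their determinants is a semi-invariant `p` for the
inverse of the character, of polynomial growth, so `‖p(y)‖² exp (-c ‖y‖²)` attains its maximum on the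
closure of the orbit; the frames at the maximum are invertible, which forces it to lie in the orbit
itself (`mem_orbit_of_mem_closure`), and there the first variation vanishes.
-/

open scoped Matrix

noncomputable section

set_option linter.unusedSectionVars false

namespace FlowHecke

/-! ### Representations, their inner product and the moment map -/

section Algebra

variable {I E : Type*} [Fintype E] {Q : EdgeQuiver I E} {v : I → ℕ}

theorem ext_mat {x y : Rep Q v} (h : ∀ a, mat x a = mat y a) : x = y := by
  rw [← ofMat_mat x, ← ofMat_mat y, funext h]

theorem mat_add (x y : Rep Q v) (a : E) : mat (x + y) a = mat x a + mat y a := rfl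
theorem mat_sub (x y : Rep Q v) (a : E) : mat (x - y) a = mat x a - mat y a := rfl
theorem mat_smul (r : ℝ) (x : Rep Q v) (a : E) : mat (r • x) a = r • mat x a := rfl
theorem mat_zero (a : E) : mat (0 : Rep Q v) a = 0 := rfl

theorem inner_eq_trace (x y : Rep Q v) :
    inner ℝ x y = ∑ a, ((mat x a)ᴴ * mat y a).trace.re := by
  rw [PiLp.inner_apply, Fintype.sum_sigma]
  refine Finset.sum_congr rfl fun a _ => ?_
  rw [Fintype.sum_prod_type_right, Matrix.trace, Complex.re_sum]
  refine Finset.sum_congr rfl fun j _ => ?_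
  rw [Matrix.diag_apply, Matrix.mul_apply, Complex.re_sum]
  refine Finset.sum_congr rfl fun i _ => ?_
  simp [mat, Complex.inner, Matrix.conjTranspose_apply, mul_comm]

/-- The representation `(p_{h(a)} x_a q_{t(a)})_a`. -/
def sandwich (p q : ∀ i : I, Matrix (Fin (v i)) (Fin (v i)) ℂ) (x : Rep Q v) : Rep Q v :=
  ofMat fun a => p (Q.head a) * mat x a * q (Q.tail a)

theorem mat_sandwich (p q : ∀ i : I, Matrix (Fin (v i)) (Fin (v i)) ℂ) (x : Rep Q v) (a : E) :
    mat (sandwich p q x) a = p (Q.head a) * mat x a * q (Q.tail a) := rfl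

theorem mat_infAct (x : Rep Q v) (u : ∀ i : I, Matrix (Fin (v i)) (Fin (v i)) ℂ) (a : E) :
    mat (infAct x u) a = u (Q.head a) * mat x a - mat x a * u (Q.tail a) := rfl

theorem mat_act (g : Gauge v) (x : Rep Q v) (a : E) :
    mat (act g x) a = (g (Q.head a)).val * mat x a * (g (Q.tail a))⁻¹.val := rfl

theorem inner_sandwich (p q : ∀ i : I, Matrix (Fin (v i)) (Fin (v i)) ℂ) (x y : Rep Q v) :
    inner ℝ (sandwich p q x) y =
      inner ℝ x (sandwich (fun i => (p i)ᴴ) (fun i => (q i)ᴴ) y) := by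
  simp only [inner_eq_trace, mat_sandwich, Matrix.conjTranspose_mul]
  refine Finset.sum_congr rfl fun a _ => ?_
  rw [Matrix.mul_assoc, Matrix.trace_mul_comm]
  simp only [Matrix.mul_assoc]

theorem infAct_add (x : Rep Q v) (u u' : ∀ i : I, Matrix (Fin (v i)) (Fin (v i)) ℂ) :
    infAct x (u + u') = infAct x u + infAct x u' := by
  refine ext_mat fun a => ?_
  simp only [mat_infAct, mat_add, Pi.add_apply, Matrix.add_mul, Matrix.mul_add]
  abel

theorem infAct_smul (x : Rep Q v) (r : ℝ) (u : ∀ i : I, Matrix (Fin (v i)) (Fin (v i)) ℂ) :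
    infAct x (r • u) = r • infAct x u := by
  refine ext_mat fun a => ?_
  simp [mat_infAct, mat_smul, smul_sub]

section Bracket

variable [Fintype I] [DecidableEq I]

theorem blockIncl_transpose_mul_self (i : I) :
    (blockIncl v i)ᵀ * blockIncl v i = 1 := by
  ext j l
  simp [blockIncl, Matrix.mul_apply, Matrix.one_apply, eq_comm]

theorem blockIncl_conjTranspose (i : I) : (blockIncl v i)ᴴ = (blockIncl v i)ᵀ := by
  ext j l
  simp [blockIncl, Matrix.conjTranspose_apply, apply_ite]

theorem mul_blockIncl {v₁ : I → ℕ} (u : ∀ i : I, Matrix (Fin (v i)) (Fin (v₁ i)) ℂ) (i : I) :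
    Matrix.blockDiagonal' u * blockIncl v₁ i = blockIncl v i * u i := by
  ext ⟨l, m⟩ j
  by_cases h : l = i
  · subst h
    simp [blockIncl, Matrix.mul_apply, Matrix.blockDiagonal'_apply]
  · simp [blockIncl, Matrix.mul_apply, Matrix.blockDiagonal'_apply, h]

theorem blockIncl_transpose_mul {v₁ : I → ℕ} (u : ∀ i : I, Matrix (Fin (v₁ i)) (Fin (v i)) ℂ)
    (i : I) : (blockIncl v₁ i)ᵀ * Matrix.blockDiagonal' u = u i * (blockIncl v i)ᵀ := by
  have h := congrArg Matrix.transpose (mul_blockIncl (fun i => (u i)ᵀ) i)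
  rw [Matrix.transpose_mul, Matrix.transpose_mul, ← Matrix.blockDiagonal'_transpose,
    Matrix.transpose_transpose, Matrix.transpose_transpose] at h
  exact h

theorem blockIncl_mul_mul_apply_of_ne (i : I) (M : Matrix (Fin (v i)) (Fin (v i)) ℂ)
    {p q : Tot v} (h : p.1 ≠ q.1) :
    (blockIncl v i * M * (blockIncl v i)ᵀ) p q = 0 := by
  obtain ⟨l, a⟩ := p
  obtain ⟨m, b⟩ := q
  rw [Matrix.mul_apply]
  refine Finset.sum_eq_zero fun j _ => ?_
  by_cases hm : m = i
  · have hl : l ≠ i := fun hl => h (hl.trans hm.symm)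
    rw [Matrix.mul_apply, Finset.sum_eq_zero, zero_mul]
    intro r _
    simp [blockIncl, hl]
  · simp [blockIncl, hm]

theorem toEnd_add (x y : Rep Q v) (a : E) : toEnd (x + y) a = toEnd x a + toEnd y a := by
  simp [toEnd, mat_add, Matrix.add_mul, Matrix.mul_add]

theorem toEnd_smul (r : ℝ) (x : Rep Q v) (a : E) : toEnd (r • x) a = r • toEnd x a := by
  simp [toEnd, mat_smul]

theorem toEnd_sandwich (p q : ∀ i : I, Matrix (Fin (v i)) (Fin (v i)) ℂ) (x : Rep Q v) (a : E) :
    toEnd (sandwich p q x) a =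
      Matrix.blockDiagonal' p * toEnd x a * Matrix.blockDiagonal' q := by
  simp only [toEnd, mat_sandwich]
  rw [Matrix.mul_assoc _ _ (Matrix.blockDiagonal' q), Matrix.mul_assoc _ _ (Matrix.blockDiagonal' q),
    blockIncl_transpose_mul, ← Matrix.mul_assoc (Matrix.blockDiagonal' p),
    ← Matrix.mul_assoc (Matrix.blockDiagonal' p), mul_blockIncl]
  simp only [Matrix.mul_assoc]

theorem toEnd_infAct (x : Rep Q v) (u : ∀ i : I, Matrix (Fin (v i)) (Fin (v i)) ℂ) (a : E) :
    toEnd (infAct x u) a =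
      Matrix.blockDiagonal' u * toEnd x a - toEnd x a * Matrix.blockDiagonal' u := by
  simp only [toEnd, mat_infAct]
  rw [Matrix.mul_assoc _ _ (Matrix.blockDiagonal' u), blockIncl_transpose_mul, ← Matrix.mul_assoc,
    ← Matrix.mul_assoc, mul_blockIncl, Matrix.mul_sub, Matrix.sub_mul]
  simp only [Matrix.mul_assoc]

theorem toEnd_conjTranspose (x : Rep Q v) (a : E) :
    (toEnd x a)ᴴ = blockIncl v (Q.tail a) * (mat x a)ᴴ * (blockIncl v (Q.head a))ᵀ := by
  rw [toEnd, Matrix.conjTranspose_mul, Matrix.conjTranspose_mul, ← blockIncl_conjTranspose,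
    Matrix.conjTranspose_conjTranspose, blockIncl_conjTranspose, Matrix.mul_assoc]

theorem trace_toEnd (x y : Rep Q v) (a : E) :
    ((toEnd x a)ᴴ * toEnd y a).trace = ((mat x a)ᴴ * mat y a).trace := by
  rw [toEnd_conjTranspose, toEnd]
  simp only [Matrix.mul_assoc]
  rw [← Matrix.mul_assoc (blockIncl v (Q.head a))ᵀ, blockIncl_transpose_mul_self,
    Matrix.one_mul, Matrix.trace_mul_comm (blockIncl v (Q.tail a))]
  simp only [Matrix.mul_assoc]
  rw [blockIncl_transpose_mul_self, Matrix.mul_one]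

/-- The sesquilinear extension `∑ₐ [x_a, y_a*]` of `x ↦ ∑ₐ [x_a, x_a*]`, as an endomorphism of
`⨁ᵢ V_i`. -/
def totalBracket (x y : Rep Q v) : Matrix (Tot v) (Tot v) ℂ :=
  ∑ a, (toEnd x a * (toEnd y a)ᴴ - (toEnd y a)ᴴ * toEnd x a)

/-- The component of `∑ₐ [x_a, y_a*]` in `End(V_i)`. -/
def bracket (x y : Rep Q v) (i : I) : Matrix (Fin (v i)) (Fin (v i)) ℂ :=
  (totalBracket x y).blockDiag' i

theorem blockDiagonal'_bracket (x y : Rep Q v) :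
    Matrix.blockDiagonal' (bracket x y) = totalBracket x y := by
  ext ⟨i, j⟩ ⟨l, m⟩
  by_cases h : i = l
  · subst h
    rw [Matrix.blockDiagonal'_apply_eq]
    rfl
  · rw [Matrix.blockDiagonal'_apply_ne _ _ _ h, totalBracket, Matrix.sum_apply,
      Finset.sum_eq_zero]
    intro a _
    have h1 : toEnd x a * (toEnd y a)ᴴ = blockIncl v (Q.head a) * (mat x a * (mat y a)ᴴ) *
        (blockIncl v (Q.head a))ᵀ := by
      rw [toEnd_conjTranspose, toEnd]
      simp only [Matrix.mul_assoc]
      rw [← Matrix.mul_assoc (blockIncl v (Q.tail a))ᵀ, blockIncl_transpose_mul_self,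
        Matrix.one_mul]
    have h2 : (toEnd y a)ᴴ * toEnd x a = blockIncl v (Q.tail a) * ((mat y a)ᴴ * mat x a) *
        (blockIncl v (Q.tail a))ᵀ := by
      rw [toEnd_conjTranspose, toEnd]
      simp only [Matrix.mul_assoc]
      rw [← Matrix.mul_assoc (blockIncl v (Q.head a))ᵀ, blockIncl_transpose_mul_self,
        Matrix.one_mul]
    rw [Matrix.sub_apply, h1, h2, blockIncl_mul_mul_apply_of_ne _ _ h,
      blockIncl_mul_mul_apply_of_ne _ _ h, sub_zero]

theorem bracket_conjTranspose (x y : Rep Q v) (i : I) : (bracket x y i)ᴴ = bracket y x i := by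
  rw [bracket, ← Matrix.blockDiag'_conjTranspose, bracket]
  congr 1
  simp [totalBracket, Matrix.conjTranspose_sum, Matrix.conjTranspose_sub]

theorem bracket_add_left (x y z : Rep Q v) : bracket (x + y) z = bracket x z + bracket y z := by
  funext i
  have h : totalBracket (x + y) z = totalBracket x z + totalBracket y z := by
    simp only [totalBracket, toEnd_add, ← Finset.sum_add_distrib, Matrix.add_mul, Matrix.mul_add]
    exact Finset.sum_congr rfl fun a _ => by abel
  rw [bracket, h, Matrix.blockDiag'_add]
  rfl

theorem bracket_smul_left (r : ℝ) (x y : Rep Q v) : bracket (r • x) y = r • bracket x y := by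
  funext i
  simp only [bracket, Pi.smul_apply, totalBracket, toEnd_smul, Matrix.smul_mul, Matrix.mul_smul,
    ← smul_sub, ← Finset.smul_sum]
  rfl

theorem bracket_add_right (x y z : Rep Q v) : bracket x (y + z) = bracket x y + bracket x z := by
  funext i
  rw [← bracket_conjTranspose, bracket_add_left, Pi.add_apply, Matrix.conjTranspose_add,
    bracket_conjTranspose, bracket_conjTranspose, Pi.add_apply]

theorem bracket_smul_right (r : ℝ) (x y : Rep Q v) : bracket x (r • y) = r • bracket x y := by
  funext i
  rw [← bracket_conjTranspose, bracket_smul_left, Pi.smul_apply, Matrix.conjTranspose_smul,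
    bracket_conjTranspose, Pi.smul_apply, star_trivial]

theorem sum_trace_bracket (x y : Rep Q v) : ∑ i, (bracket x y i).trace = 0 := by
  rw [← Matrix.trace_blockDiagonal', blockDiagonal'_bracket, totalBracket, Matrix.trace_sum]
  refine Finset.sum_eq_zero fun a _ => ?_
  rw [Matrix.trace_sub, Matrix.trace_mul_comm, sub_self]

/-- The moment map is the adjoint of the infinitesimal action. -/
theorem inner_infAct (x y : Rep Q v) (u : ∀ i : I, Matrix (Fin (v i)) (Fin (v i)) ℂ) :
    inner ℝ (infAct x u) y = ∑ i, ((u i)ᴴ * bracket y x i).trace.re := by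
  have h : ∑ i, ((u i)ᴴ * bracket y x i).trace =
      ((Matrix.blockDiagonal' u)ᴴ * totalBracket y x).trace := by
    rw [← blockDiagonal'_bracket, Matrix.blockDiagonal'_conjTranspose, ← Matrix.blockDiagonal'_mul,
      Matrix.trace_blockDiagonal']
  rw [← Complex.re_sum, h, inner_eq_trace, ← Complex.re_sum]
  congr 1
  simp only [← trace_toEnd, toEnd_infAct]
  rw [totalBracket, Matrix.mul_sum, Matrix.trace_sum]
  refine Finset.sum_congr rfl fun a _ => ?_
  rw [Matrix.conjTranspose_sub, Matrix.conjTranspose_mul, Matrix.conjTranspose_mul, Matrix.sub_mul,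
    Matrix.mul_sub, Matrix.trace_sub, Matrix.trace_sub, Matrix.mul_assoc, Matrix.trace_mul_comm,
    Matrix.mul_assoc, Matrix.mul_assoc]

theorem eq_zero_of_sum_trace_eq_zero {Z : ∀ i : I, Matrix (Fin (v i)) (Fin (v i)) ℂ}
    (h : ∑ i, ((Z i)ᴴ * Z i).trace.re = 0) : Z = 0 := by
  have h2 : ∀ i : I, ((Z i)ᴴ * Z i).trace.re = ∑ j, ∑ l, ‖Z i l j‖ ^ 2 := by
    intro i
    rw [Matrix.trace, Complex.re_sum]
    refine Finset.sum_congr rfl fun j _ => ?_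
    rw [Matrix.diag_apply, Matrix.mul_apply, Complex.re_sum]
    refine Finset.sum_congr rfl fun l _ => ?_
    rw [Matrix.conjTranspose_apply, ← Complex.normSq_eq_norm_sq, Complex.star_def,
      ← Complex.normSq_eq_conj_mul_self, Complex.ofReal_re]
  simp only [h2] at h
  funext i
  ext l j
  rw [Finset.sum_eq_zero_iff_of_nonneg (fun i _ => by positivity)] at h
  have h3 := h i (Finset.mem_univ i)
  rw [Finset.sum_eq_zero_iff_of_nonneg (fun i _ => by positivity)] at h3
  have h4 := h3 j (Finset.mem_univ j)
  rw [Finset.sum_eq_zero_iff_of_nonneg (fun i _ => by positivity)] at h4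
  simpa using h4 l (Finset.mem_univ l)

theorem bracket_eq_zero {x y : Rep Q v}
    (h : ∀ u : ∀ i : I, Matrix (Fin (v i)) (Fin (v i)) ℂ, inner ℝ (infAct x u) y = 0) :
    bracket y x = 0 :=
  eq_zero_of_sum_trace_eq_zero (by rw [← inner_infAct, h])

end Bracket
end Algebra
/-! ### Gradient and Hessian of the energy -/

section Calculus

variable {I E : Type*} [Fintype E] {Q : EdgeQuiver I E} {v : I → ℕ}
variable [Fintype I] [DecidableEq I]

/-- The `i`-th block of `2i (μ(x) - α)`: the Hermitian matrix `∑ₐ [x_a, x_a*] + 2 α_i`. -/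
def shiftedMoment (α : I → ℤ) (x : Rep Q v) (i : I) : Matrix (Fin (v i)) (Fin (v i)) ℂ :=
  bracket x x i + (2 * α i : ℂ) • (1 : Matrix (Fin (v i)) (Fin (v i)) ℂ)

/-- The derivative of `x ↦ ∑ₐ [x_a, x_a*]` in the direction `δ`. -/
def derivMoment (x δ : Rep Q v) : ∀ i : I, Matrix (Fin (v i)) (Fin (v i)) ℂ :=
  bracket δ x + bracket x δ

/-- The norms of `μ - α` and of `H = shiftedMoment α x` differ by the factor `1 / |2i|`, and `H` has
no off-diagonal blocks. -/
theorem momentMap_sub_centralElement (α : I → ℤ) (x : Rep Q v) :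
    momentMap x - centralElement v α =
      (1 / (2 * Complex.I)) • Matrix.blockDiagonal' (shiftedMoment α x) := by
  have h1 : Matrix.blockDiagonal' (shiftedMoment α x) =
      totalBracket x x + Matrix.diagonal fun p : Tot v => (2 * α p.1 : ℂ) := by
    rw [← blockDiagonal'_bracket, ← Matrix.blockDiagonal'_diagonal fun i _ => (2 * α i : ℂ),
      ← Matrix.blockDiagonal'_add]
    congr 1
    funext i
    simp [shiftedMoment, Matrix.smul_one_eq_diagonal]
  rw [h1, smul_add, sub_eq_add_neg]
  congr 1
  rw [centralElement, Matrix.diagonal_neg, ← Matrix.diagonal_smul]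
  congr 1
  funext p
  simp only [Pi.smul_apply, smul_eq_mul]
  field_simp
  simp

theorem energy_eq (α : I → ℤ) (x : Rep Q v) :
    energy α x = (1 / 8) * ∑ i, ∑ j, ∑ l, ‖shiftedMoment α x i j l‖ ^ 2 := by
  have h : ∀ p q : Tot v, ‖(momentMap x - centralElement v α) p q‖ ^ 2 =
      (1 / 4) * ‖Matrix.blockDiagonal' (shiftedMoment α x) p q‖ ^ 2 := by
    intro p q
    rw [momentMap_sub_centralElement, Matrix.smul_apply, norm_smul]
    simp [mul_pow]
    norm_num
  simp only [energy, h, ← Finset.mul_sum]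
  rw [← mul_assoc]
  congr 1
  · norm_num
  rw [Fintype.sum_sigma]
  refine Finset.sum_congr rfl fun i _ => Finset.sum_congr rfl fun j _ => ?_
  rw [Fintype.sum_sigma, Finset.sum_eq_single i]
  · simp only [Matrix.blockDiagonal'_apply_eq]
  · intro l _ hl
    simp [Matrix.blockDiagonal'_apply_ne _ _ _ hl.symm]
  · simp

theorem shiftedMoment_conjTranspose (α : I → ℤ) (x : Rep Q v) (i : I) :
    (shiftedMoment α x i)ᴴ = shiftedMoment α x i := by
  simp [shiftedMoment, bracket_conjTranspose, Matrix.conjTranspose_smul]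

theorem shiftedMoment_line (α : I → ℤ) (x δ : Rep Q v) (t : ℝ) (i : I) :
    shiftedMoment α (x + t • δ) i =
      shiftedMoment α x i + t • (derivMoment x δ i + t • bracket δ δ i) := by
  simp only [shiftedMoment, derivMoment, bracket_add_left, bracket_add_right, bracket_smul_left,
    bracket_smul_right, Pi.add_apply, Pi.smul_apply, smul_add]
  abel

/-- A function equal to `t ↦ a + t • K(t)` near `0`, where `K` has limit `b` at `0`, has derivative
`b` there. -/
theorem hasDerivAt_add_smul {V : Type*} [NormedAddCommGroup V] [NormedSpace ℝ V] {F K : ℝ → V}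
    {a b : V} (hF : ∀ᶠ t in nhds 0, F t = a + t • K t)
    (hK : Filter.Tendsto K (nhds 0) (nhds b)) : HasDerivAt F b 0 := by
  rw [hasDerivAt_iff_tendsto_slope_zero]
  refine (tendsto_nhdsWithin_of_tendsto_nhds hK).congr' ?_
  filter_upwards [self_mem_nhdsWithin, nhdsWithin_le_nhds hF] with t ht hFt
  have : t ≠ 0 := ht
  rw [zero_add, hFt, hF.self_of_nhds, zero_smul, add_zero, add_sub_cancel_left, smul_smul,
    inv_mul_cancel₀ this, one_smul]

theorem differentiable_toEnd (a : E) (p q : Tot v) :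
    Differentiable ℝ fun x : Rep Q v => toEnd x a p q := by
  simp only [toEnd, Matrix.mul_apply, mat, Matrix.of_apply]
  fun_prop

theorem differentiable_bracket (i : I) (j l : Fin (v i)) :
    Differentiable ℝ fun x : Rep Q v => bracket x x i j l := by
  have h := fun a p q => differentiable_toEnd (Q := Q) (v := v) a p q
  simp only [bracket, Matrix.blockDiag'_apply, totalBracket, Matrix.sum_apply, Matrix.sub_apply,
    Matrix.mul_apply, Matrix.conjTranspose_apply]
  fun_prop

theorem differentiable_shiftedMoment (α : I → ℤ) (i : I) (j l : Fin (v i)) :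
    Differentiable ℝ fun x : Rep Q v => shiftedMoment α x i j l := by
  simp only [shiftedMoment, Matrix.add_apply]
  exact (differentiable_bracket i j l).add_const _

theorem differentiable_energy (α : I → ℤ) : Differentiable ℝ (energy α : Rep Q v → ℝ) := by
  have h := fun i j l => differentiable_shiftedMoment (Q := Q) (v := v) α i j l
  rw [funext (energy_eq α)]
  refine Differentiable.const_mul ?_ _
  refine Differentiable.fun_sum fun i _ => Differentiable.fun_sum fun j _ =>
    Differentiable.fun_sum fun l _ => ?_
  exact (h i j l).norm_sq ℝ

theorem hasDerivAt_shiftedMoment (α : I → ℤ) (x δ : Rep Q v) (i : I) (j l : Fin (v i)) :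
    HasDerivAt (fun t : ℝ => shiftedMoment α (x + t • δ) i j l) (derivMoment x δ i j l) 0 := by
  refine hasDerivAt_add_smul (a := shiftedMoment α x i j l)
    (K := fun t => derivMoment x δ i j l + t • bracket δ δ i j l)
    (Filter.Eventually.of_forall fun t => ?_) ?_
  · rw [shiftedMoment_line]
    simp [Matrix.add_apply]
  · refine (Continuous.tendsto' (by fun_prop) _ _ ?_)
    simp

theorem hasDerivAt_energy (α : I → ℤ) (x δ : Rep Q v) :
    HasDerivAt (fun t : ℝ => energy α (x + t • δ))
      ((1 / 4) * ∑ i, ((shiftedMoment α x i)ᴴ * derivMoment x δ i).trace.re) 0 := by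
  have h : HasDerivAt (fun t : ℝ => energy α (x + t • δ))
      ((1 / 8) * ∑ i, ∑ j, ∑ l,
        2 * inner ℝ (shiftedMoment α (x + (0 : ℝ) • δ) i j l) (derivMoment x δ i j l)) 0 := by
    simp only [energy_eq]
    refine HasDerivAt.const_mul _ ?_
    refine HasDerivAt.fun_sum fun i _ => HasDerivAt.fun_sum fun j _ =>
      HasDerivAt.fun_sum fun l _ => ?_
    exact (hasDerivAt_shiftedMoment α x δ i j l).norm_sq
  convert h using 1
  simp only [← Finset.mul_sum, zero_smul, add_zero]
  rw [← mul_assoc]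
  congr 1
  · norm_num
  refine Finset.sum_congr rfl fun i _ => ?_
  rw [Matrix.trace, Complex.re_sum, Finset.sum_comm]
  refine Finset.sum_congr rfl fun j _ => ?_
  rw [Matrix.diag_apply, Matrix.mul_apply, Complex.re_sum]
  refine Finset.sum_congr rfl fun l _ => ?_
  rw [Complex.inner, Matrix.conjTranspose_apply, Complex.star_def, mul_comm]

theorem sum_trace_derivMoment (x δ : Rep Q v) (u : ∀ i : I, Matrix (Fin (v i)) (Fin (v i)) ℂ)
    (hu : ∀ i, (u i)ᴴ = u i) :
    ∑ i, ((u i)ᴴ * derivMoment x δ i).trace.re = 2 * inner ℝ (infAct x u) δ := by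
  rw [inner_infAct, two_mul, ← Finset.sum_add_distrib]
  refine Finset.sum_congr rfl fun i _ => ?_
  have h : ((u i)ᴴ * bracket x δ i).trace.re = ((u i)ᴴ * bracket δ x i).trace.re := by
    rw [← bracket_conjTranspose δ x, ← Matrix.conjTranspose_mul, Matrix.trace_conjTranspose,
      Complex.star_def, Complex.conj_re, Matrix.trace_mul_comm, hu]
  rw [derivMoment, Pi.add_apply, Matrix.mul_add, Matrix.trace_add, Complex.add_re, h]

/-- The gradient is found from the derivatives along lines, since the energy is differentiable and
the moment map is the adjoint of the infinitesimal action. -/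
theorem gradient_energy (α : I → ℤ) (x : Rep Q v) :
    gradient (energy α) x = (1 / 2 : ℝ) • infAct x (shiftedMoment α x) := by
  refine HasGradientAt.gradient ?_
  rw [hasGradientAt_iff_hasFDerivAt]
  have hd := (differentiable_energy (Q := Q) (v := v) α x).hasFDerivAt
  suffices h : InnerProductSpace.toDual ℝ (Rep Q v)
      ((1 / 2 : ℝ) • infAct x (shiftedMoment α x)) = fderiv ℝ (energy α) x by
    rw [h]; exact hd
  apply ContinuousLinearMap.ext
  intro δ
  have h1 : HasDerivAt (fun t : ℝ => energy α (x + t • δ)) (fderiv ℝ (energy α) x δ) 0 :=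
    hd.hasLineDerivAt δ
  rw [h1.unique (hasDerivAt_energy α x δ), InnerProductSpace.toDual_apply_apply,
    sum_trace_derivMoment _ _ _ (shiftedMoment_conjTranspose α x), inner_smul_left]
  simp
  ring

theorem isCritical_iff (α : I → ℤ) (x : Rep Q v) :
    IsCritical α x ↔ infAct x (shiftedMoment α x) = 0 := by
  rw [IsCritical, gradient_energy, smul_eq_zero]
  simp

theorem infAct_add_left (x y : Rep Q v) (u : ∀ i : I, Matrix (Fin (v i)) (Fin (v i)) ℂ) :
    infAct (x + y) u = infAct x u + infAct y u := by
  refine ext_mat fun a => ?_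
  simp only [mat_infAct, mat_add, Matrix.add_mul, Matrix.mul_add]
  abel

theorem infAct_smul_left (x : Rep Q v) (r : ℝ) (u : ∀ i : I, Matrix (Fin (v i)) (Fin (v i)) ℂ) :
    infAct (r • x) u = r • infAct x u := by
  refine ext_mat fun a => ?_
  simp [mat_infAct, mat_smul, smul_sub]

theorem hessian_apply (α : I → ℤ) (x δ : Rep Q v) :
    hessian α x δ =
      (1 / 2 : ℝ) • (infAct δ (shiftedMoment α x) + infAct x (derivMoment x δ)) := by
  have hdiff : Differentiable ℝ (gradient (energy α) : Rep Q v → Rep Q v) := by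
    rw [funext (gradient_energy α)]
    refine Differentiable.const_smul (R := ℝ)
      (f := fun x : Rep Q v => infAct x (shiftedMoment α x)) ?_ _
    refine (differentiable_piLp 2).2 ?_
    rintro ⟨a, j, l⟩
    have h := fun i j l => differentiable_shiftedMoment (Q := Q) (v := v) α i j l
    simp only [infAct, ofMat, Matrix.sub_apply, Matrix.mul_apply, mat, Matrix.of_apply]
    fun_prop
  have hd := (hdiff x).hasFDerivAt
  have h1 : HasDerivAt (fun t : ℝ => gradient (energy α) (x + t • δ)) (hessian α x δ) 0 :=
    hd.hasLineDerivAt δ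
  refine h1.unique ?_
  refine hasDerivAt_add_smul (a := gradient (energy α) x)
    (K := fun t => (1 / 2 : ℝ) • (infAct δ (shiftedMoment α x) + infAct x (derivMoment x δ) +
      t • (infAct x (bracket δ δ) + infAct δ (derivMoment x δ) + t • infAct δ (bracket δ δ))))
    (Filter.Eventually.of_forall fun t => ?_) ?_
  · have h2 : shiftedMoment α (x + t • δ) =
        shiftedMoment α x + t • (derivMoment x δ + t • bracket δ δ) :=
      funext fun i => shiftedMoment_line α x δ t i
    rw [gradient_energy, gradient_energy, h2]
    simp only [infAct_add, infAct_smul, infAct_add_left, infAct_smul_left]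
    module
  · refine (Continuous.tendsto' (by fun_prop) _ _ ?_)
    simp

end Calculus
/-! ### The negative slice -/

section NegativeSlice

variable {I E : Type*} [Fintype E] {Q : EdgeQuiver I E} {v : I → ℕ}

/-- The complement of the image of the infinitesimal action is stable under compressions by
Hermitian families commuting with `x`. -/
theorem inner_infAct_sandwich {x δ : Rep Q v} (q r : ∀ i : I, Matrix (Fin (v i)) (Fin (v i)) ℂ)
    (hq : ∀ i, (q i)ᴴ = q i) (hr : ∀ i, (r i)ᴴ = r i)
    (hqx : ∀ a, q (Q.head a) * mat x a = mat x a * q (Q.tail a))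
    (hrx : ∀ a, r (Q.head a) * mat x a = mat x a * r (Q.tail a))
    (h : ∀ u : ∀ i : I, Matrix (Fin (v i)) (Fin (v i)) ℂ, inner ℝ (infAct x u) δ = 0)
    (u : ∀ i : I, Matrix (Fin (v i)) (Fin (v i)) ℂ) :
    inner ℝ (infAct x u) (sandwich q r δ) = 0 := by
  rw [real_inner_comm, inner_sandwich, real_inner_comm, funext hq, funext hr]
  have h1 : sandwich q r (infAct x u) = infAct x (q * u * r) := by
    refine ext_mat fun a => ?_
    simp only [mat_sandwich, mat_infAct, Pi.mul_apply, Matrix.mul_sub, Matrix.sub_mul,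
      Matrix.mul_assoc, hrx]
    simp only [← Matrix.mul_assoc, hqx]
  rw [h1, h]

theorem inner_infAct_comm (x y : Rep Q v) (u : ∀ i : I, Matrix (Fin (v i)) (Fin (v i)) ℂ)
    (hu : ∀ i, (u i)ᴴ = u i) : inner ℝ (infAct x u) y = inner ℝ x (infAct y u) := by
  have h : ∀ z : Rep Q v, infAct z u = sandwich u (fun _ => 1) z - sandwich (fun _ => 1) u z := by
    intro z
    refine ext_mat fun a => ?_
    simp [mat_sub, mat_infAct, mat_sandwich]
  rw [h, h, inner_sub_left, inner_sub_right, inner_sandwich, inner_sandwich, funext hu]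
  simp

variable [Fintype I] [DecidableEq I]

/-- On the complement of the image of the infinitesimal action the Hessian is half the commutator
with `H = shiftedMoment α x`, so that an eigenvector of this commutator with nonnegative eigenvalue
is orthogonal to the negative eigenspace. -/
theorem inner_negEigenspace_eq_zero {α : I → ℤ} {x η δ : Rep Q v} {s : ℝ} (hs : 0 ≤ s)
    (hη : ∀ u : ∀ i : I, Matrix (Fin (v i)) (Fin (v i)) ℂ, inner ℝ (infAct x u) η = 0)
    (hsη : infAct η (shiftedMoment α x) = s • η) (hδ : δ ∈ negEigenspace α x) :
    inner ℝ δ η = 0 := by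
  have h : negEigenspace α x ≤ (Submodule.span ℝ {η})ᗮ := by
    refine iSup₂_le fun r hr e he => ?_
    rw [Submodule.mem_orthogonal_singleton_iff_inner_left]
    have h1 : hessian α x e = r • e := Module.End.mem_eigenspace_iff.1 he
    have h2 : inner ℝ (hessian α x e) η = s / 2 * inner ℝ e η := by
      rw [hessian_apply, inner_smul_left, inner_add_left, hη, add_zero,
        inner_infAct_comm _ _ _ (shiftedMoment_conjTranspose α x), hsη, inner_smul_right]
      simp
      ring
    rw [h1, inner_smul_left] at h2
    have hr' : r < 0 := hr
    have h3 : (r - s / 2) * inner ℝ e η = 0 := by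
      rw [sub_mul, ← h2]
      simp
    rcases mul_eq_zero.1 h3 with h4 | h4
    · linarith
    · exact h4
  exact (Submodule.mem_orthogonal_singleton_iff_inner_left).1 (h hδ)

variable {α : I → ℤ} {x : Rep Q v} {p : ∀ i : I, Matrix (Fin (v i)) (Fin (v i)) ℂ} {h₁ h₂ : ℝ}

/-- If `H = shiftedMoment α x` has eigenvalues `h₁ < h₂`, with eigenspaces the image and the kernel
of `p`, then a negative direction orthogonal to the orbit maps the image of `p` to zero. -/
theorem mat_mul_eq_zero_of_mem_negEigenspace (hp : ∀ i, (p i)ᴴ = p i) (hpp : ∀ i, p i * p i = p i)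
    (hpx : ∀ a, p (Q.head a) * mat x a = mat x a * p (Q.tail a)) (hh : h₁ ≤ h₂)
    (hH : ∀ i, shiftedMoment α x i = h₁ • p i + h₂ • (1 - p i)) {δ : Rep Q v}
    (hδ : ∀ u : ∀ i : I, Matrix (Fin (v i)) (Fin (v i)) ℂ, inner ℝ (infAct x u) δ = 0)
    (hneg : δ ∈ negEigenspace α x) (a : E) : mat δ a * p (Q.tail a) = 0 := by
  have hcp : ∀ i, (1 - p i)ᴴ = 1 - p i := fun i => by simp [hp]
  have hcpx : ∀ a, (1 - p (Q.head a)) * mat x a = mat x a * (1 - p (Q.tail a)) := fun a => by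
    simp [Matrix.sub_mul, Matrix.mul_sub, hpx]
  have hcc : ∀ i, (1 - p i) * (1 - p i) = 1 - p i := fun i => by
    simp [Matrix.sub_mul, Matrix.mul_sub, hpp]
  have key : ∀ q : ∀ i : I, Matrix (Fin (v i)) (Fin (v i)) ℂ, (∀ i, (q i)ᴴ = q i) →
      (∀ i, q i * q i = q i) → inner ℝ δ (sandwich q p δ) = 0 → sandwich q p δ = 0 := by
    intro q hq hqq h0
    have h1 : sandwich q p (sandwich q p δ) = sandwich q p δ := by
      refine ext_mat fun a => ?_
      simp only [mat_sandwich]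
      rw [Matrix.mul_assoc, Matrix.mul_assoc, hpp, ← Matrix.mul_assoc, ← Matrix.mul_assoc, hqq]
    have h2 : inner ℝ (sandwich q p δ) (sandwich q p δ) = 0 := by
      rw [inner_sandwich, funext hq, funext hp, h1, h0]
    exact inner_self_eq_zero.1 h2
  have e1 : sandwich p p δ = 0 := by
    refine key p hp hpp (inner_negEigenspace_eq_zero le_rfl
      (inner_infAct_sandwich p p hp hp hpx hpx hδ) ?_ hneg)
    refine ext_mat fun a => ?_
    simp only [mat_infAct, mat_sandwich, hH]
    have i1 : (h₁ • p (Q.head a) + h₂ • (1 - p (Q.head a))) * p (Q.head a) =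
        h₁ • p (Q.head a) := by
      simp [Matrix.add_mul, Matrix.sub_mul, hpp]
    have i2 : p (Q.tail a) * (h₁ • p (Q.tail a) + h₂ • (1 - p (Q.tail a))) =
        h₁ • p (Q.tail a) := by
      simp [Matrix.mul_add, Matrix.mul_sub, hpp]
    rw [Matrix.mul_assoc _ (p (Q.tail a)), i2, Matrix.mul_assoc (p (Q.head a)),
      ← Matrix.mul_assoc, i1]
    simp [Matrix.mul_assoc, mat_zero]
  have e2 : sandwich (fun i => 1 - p i) p δ = 0 := by
    refine key _ hcp hcc (inner_negEigenspace_eq_zero (sub_nonneg.2 hh)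
      (inner_infAct_sandwich _ p hcp hp hcpx hpx hδ) ?_ hneg)
    refine ext_mat fun a => ?_
    simp only [mat_infAct, mat_sandwich, mat_smul, hH]
    have i1 : (h₁ • p (Q.head a) + h₂ • (1 - p (Q.head a))) * (1 - p (Q.head a)) =
        h₂ • (1 - p (Q.head a)) := by
      rw [Matrix.add_mul, Matrix.smul_mul, Matrix.smul_mul, hcc, Matrix.mul_sub, hpp,
        Matrix.mul_one, sub_self, smul_zero, zero_add]
    have i2 : p (Q.tail a) * (h₁ • p (Q.tail a) + h₂ • (1 - p (Q.tail a))) =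
        h₁ • p (Q.tail a) := by
      simp [Matrix.mul_add, Matrix.mul_sub, hpp]
    rw [Matrix.mul_assoc _ (p (Q.tail a)), i2, Matrix.mul_assoc (1 - p (Q.head a)),
      ← Matrix.mul_assoc, i1]
    simp [Matrix.mul_assoc, sub_smul]
  have f1 : p (Q.head a) * mat δ a * p (Q.tail a) = 0 := congrArg (fun z => mat z a) e1
  have f2 : (1 - p (Q.head a)) * mat δ a * p (Q.tail a) = 0 := congrArg (fun z => mat z a) e2
  rw [Matrix.sub_mul, Matrix.sub_mul, f1, Matrix.one_mul, sub_zero] at f2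
  exact f2

/-- Conversely, a direction orthogonal to the orbit that maps the kernel of `p` to its image is an
eigenvector of the Hessian, with eigenvalue `(h₁ - h₂) / 2`. -/
theorem mem_negEigenspace (hh : h₁ < h₂)
    (hH : ∀ i, shiftedMoment α x i = h₁ • p i + h₂ • (1 - p i)) {δ : Rep Q v}
    (hδ : ∀ u : ∀ i : I, Matrix (Fin (v i)) (Fin (v i)) ℂ, inner ℝ (infAct x u) δ = 0)
    (hl : ∀ a, p (Q.head a) * mat δ a = mat δ a) (hr : ∀ a, mat δ a * p (Q.tail a) = 0) :
    δ ∈ negEigenspace α x := by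
  have hb : bracket δ x = 0 := bracket_eq_zero hδ
  have hd : derivMoment x δ = 0 := by
    funext i
    rw [derivMoment, Pi.add_apply, ← bracket_conjTranspose δ x, hb]
    simp
  have h0 : infAct x (0 : ∀ i : I, Matrix (Fin (v i)) (Fin (v i)) ℂ) = 0 := by
    refine ext_mat fun a => ?_
    simp [mat_infAct, mat_zero]
  have hmem : δ ∈ Module.End.eigenspace (hessian α x : Module.End ℝ (Rep Q v)) ((h₁ - h₂) / 2) := by
    rw [Module.End.mem_eigenspace_iff]
    change hessian α x δ = _
    rw [hessian_apply, hd, h0, add_zero]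
    refine ext_mat fun a => ?_
    simp only [mat_smul, mat_infAct, hH, Matrix.add_mul, Matrix.mul_add, Matrix.smul_mul,
      Matrix.mul_smul, Matrix.sub_mul, Matrix.mul_sub, hl, hr, Matrix.one_mul, Matrix.mul_one]
    module
  have hlt : (h₁ - h₂) / 2 ∈ Set.Iio (0 : ℝ) := by
    rw [Set.mem_Iio]
    linarith
  exact Submodule.mem_iSup_of_mem _ (Submodule.mem_iSup_of_mem hlt hmem)

end NegativeSlice
/-! ### Stability and costability -/

section StabilityTransport

variable {I E : Type*} [Fintype I] [Fintype E] {Q : EdgeQuiver I E} {v : I → ℕ}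

theorem character_ne_zero (α : I → ℤ) (g : Gauge v) : character α g ≠ 0 :=
  Finset.prod_ne_zero_iff.2 fun i _ =>
    zpow_ne_zero _ ((Matrix.isUnit_iff_isUnit_det _).1 (g i).isUnit).ne_zero

theorem character_mul (α : I → ℤ) (g h : Gauge v) :
    character α (g * h) = character α g * character α h := by
  simp [character, Finset.prod_mul_distrib, mul_zpow]

/-- Replacing `x` by `g · x` rescales the fibre coordinate of the lifted orbits. -/
theorem liftedOrbit_act (α : I → ℤ) (g : Gauge v) (x : Rep Q v) (ξ : ℂ) :
    liftedOrbit α (act g x) ξ = liftedOrbit α x ((character α g)⁻¹ * ξ) := by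
  have hg := character_ne_zero α g
  ext p
  constructor
  · rintro ⟨h, rfl⟩
    refine ⟨h * g, ?_⟩
    simp only [act_mul, character_mul]
    congr 1
    field_simp
  · rintro ⟨h, rfl⟩
    refine ⟨h * g⁻¹, ?_⟩
    have h1 : character α h = character α (h * g⁻¹) * character α g := by
      rw [← character_mul, inv_mul_cancel_right]
    simp only [← act_mul, inv_mul_cancel_right, h1]
    congr 1
    field_simp

theorem isStable_act {α : I → ℤ} {x : Rep Q v} (hx : IsStable α x) (g : Gauge v) :
    IsStable α (act g x) := by
  have hg := character_ne_zero α g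
  refine ⟨⟨fun ξ hξ => ?_, fun ξ hξ => ?_⟩, fun h hh => ?_⟩
  · rw [liftedOrbit_act]
    exact hx.1.1 _ (mul_ne_zero (inv_ne_zero hg) hξ)
  · rw [liftedOrbit_act]
    exact hx.1.2 _ (mul_ne_zero (inv_ne_zero hg) hξ)
  · obtain ⟨c, hc⟩ := hx.2 (g⁻¹ * h * g) (by
      rw [act_mul, act_mul, hh, ← act_mul, inv_mul_cancel, act_one])
    refine ⟨c, fun i => ?_⟩
    have h1 : h i = g i * (g⁻¹ * h * g) i * (g i)⁻¹ := by
      simp [mul_assoc]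
    rw [h1, Units.val_mul, Units.val_mul, hc]
    simp

end StabilityTransport

section Costable

variable {I E : Type*} [Fintype E] {Q : EdgeQuiver (Option I) E} {w : I → ℕ}

/-- A representation is costable if it has no nonzero subrepresentation vanishing at `∞`. -/
def IsCostable (x : Rep Q (dimVec w)) : Prop :=
  ∀ S : ∀ i, Submodule ℂ (Fin (dimVec w i) → ℂ), S none = ⊥ →
    (∀ a, ∀ m ∈ S (Q.tail a), mat x a *ᵥ m ∈ S (Q.head a)) → ∀ i, S i = ⊥

/-- Every subspace of `ℂⁿ` is the image of an idempotent matrix. -/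
theorem exists_projection {n : ℕ} (S : Submodule ℂ (Fin n → ℂ)) :
    ∃ P : Matrix (Fin n) (Fin n) ℂ, (∀ m, P *ᵥ m ∈ S) ∧ ∀ m ∈ S, P *ᵥ m = m := by
  obtain ⟨f, hf⟩ := S.subtype.exists_leftInverse_of_injective S.ker_subtype
  refine ⟨LinearMap.toMatrix' (S.subtype ∘ₗ f), fun m => ?_, fun m hm => ?_⟩
  · rw [LinearMap.toMatrix'_mulVec]
    exact (f m).2
  · rw [LinearMap.toMatrix'_mulVec]
    exact congrArg Subtype.val (LinearMap.congr_fun hf ⟨m, hm⟩)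

/-- The one-parameter subgroup acting by `t` on the image of an idempotent and by `1` on its
kernel. -/
def scaleUnit {n : ℕ} (P : Matrix (Fin n) (Fin n) ℂ) (hP : P * P = P) (t : ℂ) (ht : t ≠ 0) :
    GL (Fin n) ℂ where
  val := t • P + (1 - P)
  inv := t⁻¹ • P + (1 - P)
  val_inv := by
    simp [Matrix.add_mul, Matrix.mul_add, Matrix.mul_sub, Matrix.sub_mul, hP, smul_smul,
      inv_mul_cancel₀ ht]
  inv_val := by
    simp [Matrix.add_mul, Matrix.mul_add, Matrix.mul_sub, Matrix.sub_mul, hP, smul_smul,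
      mul_inv_cancel₀ ht]

variable [Fintype I]

theorem character_canonicalParam (g : Gauge (dimVec w)) :
    character (canonicalParam w) g =
      ((g none).val.det ^ (∑ i, w i))⁻¹ * ∏ i : I, (g (some i)).val.det := by
  simp only [character, Fintype.prod_option, canonicalParam, zpow_one, zpow_neg]
  congr 2
  exact_mod_cast rfl

/-- Semistability for the canonical parameter implies costability: on a subrepresentation vanishing
at `∞`, the one-parameter subgroup scaling it by `t → 0` has a limit on which the character
vanishes. -/
theorem isCostable_of_isSemistable {x : Rep Q (dimVec w)}
    (hx : IsSemistable (canonicalParam w) x) : IsCostable x := by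
  intro S h0 hS
  choose P hP1 hP2 using fun i => exists_projection (S i)
  have hPP : ∀ i, P i * P i = P i := fun i => by
    refine Matrix.ext_of_mulVec_single fun j => ?_
    rw [← Matrix.mulVec_mulVec, hP2 i _ (hP1 i _)]
  have hPx : ∀ a, P (Q.head a) * mat x a * P (Q.tail a) = mat x a * P (Q.tail a) := fun a => by
    refine Matrix.ext_of_mulVec_single fun j => ?_
    rw [Matrix.mul_assoc, ← Matrix.mulVec_mulVec, hP2]
    rw [← Matrix.mulVec_mulVec]
    exact hS a _ (hP1 _ _)
  have hP0 : P none = 0 := by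
    refine Matrix.ext_of_mulVec_single fun j => ?_
    have := hP1 none (Pi.single j 1)
    rw [h0, Submodule.mem_bot] at this
    rw [this, Matrix.zero_mulVec]
  by_contra! hne
  obtain ⟨i₀, hi₀⟩ := hne
  obtain ⟨m, hm, hm0⟩ := (Submodule.ne_bot_iff _).1 hi₀
  -- the limit curve and the value of the character along it
  let y : ℂ → Rep Q (dimVec w) := fun t => ofMat fun a =>
    mat x a * P (Q.tail a) + (1 - P (Q.head a)) * mat x a +
      t • (P (Q.head a) * mat x a * (1 - P (Q.tail a)))
  let d : ℂ → ℂ := fun t => ∏ i : I, (t • P (some i) + (1 - P (some i))).det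
  have hd0 : d 0 = 0 := by
    cases i₀ with
    | none => exact absurd h0 hi₀
    | some i =>
      refine Finset.prod_eq_zero (Finset.mem_univ i) ?_
      rw [zero_smul, zero_add]
      refine Matrix.exists_mulVec_eq_zero_iff.1 ⟨m, hm0, ?_⟩
      rw [Matrix.sub_mulVec, Matrix.one_mulVec, hP2 _ _ hm, sub_self]
  have hmem : ∀ t : ℂ, t ≠ 0 → (y t, d t) ∈ liftedOrbit (canonicalParam w) x 1 := by
    intro t ht
    refine ⟨fun i => scaleUnit (P i) (hPP i) t ht, ?_⟩
    refine Prod.ext ?_ ?_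
    · refine ext_mat fun a => ?_
      change (t • P (Q.head a) + (1 - P (Q.head a))) * mat x a *
        (t⁻¹ • P (Q.tail a) + (1 - P (Q.tail a))) = _
      have h1 : (t • P (Q.head a) + (1 - P (Q.head a))) * mat x a * P (Q.tail a) =
          t • (mat x a * P (Q.tail a)) := by
        rw [Matrix.add_mul, Matrix.sub_mul, Matrix.add_mul, Matrix.sub_mul, Matrix.smul_mul,
          Matrix.smul_mul, Matrix.one_mul, hPx, sub_self, add_zero]
      rw [Matrix.mul_add, Matrix.mul_smul, h1, smul_smul, inv_mul_cancel₀ ht, one_smul]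
      have h2 : (1 - P (Q.head a)) * mat x a * (1 - P (Q.tail a)) =
          (1 - P (Q.head a)) * mat x a := by
        rw [Matrix.mul_sub, Matrix.mul_one, Matrix.sub_mul, Matrix.sub_mul, hPx,
          Matrix.one_mul, sub_self, sub_zero]
      rw [Matrix.add_mul, Matrix.add_mul, h2, Matrix.smul_mul, Matrix.smul_mul]
      simp only [y, mat_ofMat]
      abel
    · simp only [character_canonicalParam, scaleUnit, hP0]
      simp [d]
  have hcont : Continuous fun t => (y t, d t) := by
    refine Continuous.prodMk ?_ ?_
    · refine (PiLp.continuous_toLp 2 _).comp ?_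
      refine continuous_pi fun q => ?_
      simp only [Matrix.add_apply, Matrix.smul_apply]
      fun_prop
    · exact continuous_finsetProd _ fun i _ =>
        Continuous.matrix_det (by fun_prop)
  have hcl : (y 0, d 0) ∈ closure (liftedOrbit (canonicalParam w) x 1) := by
    refine mem_closure_of_tendsto (b := nhdsWithin (0 : ℂ) {0}ᶜ)
      (tendsto_nhdsWithin_of_tendsto_nhds (hcont.tendsto 0)) ?_
    filter_upwards [self_mem_nhdsWithin] with t ht using hmem t ht
  have := hx 1 one_ne_zero
  exact (Set.eq_empty_iff_forall_notMem.1 this) _ ⟨hcl, hd0⟩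


/-- The functionals on `V_i` obtained by composing the maps of a representation along a path from
`i` to `∞`, as functions of the representation. -/
inductive IsPathFunctional (Q : EdgeQuiver (Option I) E) (w : I → ℕ) :
    ∀ i : Option I, (Rep Q (dimVec w) → Fin (dimVec w i) → ℂ) → Prop
  | base : IsPathFunctional Q w none fun _ _ => 1
  | step (a : E) (φ : Rep Q (dimVec w) → Fin (dimVec w (Q.head a)) → ℂ) :
      IsPathFunctional Q w (Q.head a) φ →
        IsPathFunctional Q w (Q.tail a) fun y => φ y ᵥ* mat y a

theorem continuous_mat (a : E) : Continuous fun y : Rep Q (dimVec w) => mat y a := by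
  refine continuous_matrix fun i j => ?_
  simp only [mat, Matrix.of_apply]
  fun_prop

theorem IsPathFunctional.continuous {i : Option I} {φ : Rep Q (dimVec w) → Fin (dimVec w i) → ℂ}
    (h : IsPathFunctional Q w i φ) : Continuous φ := by
  induction h with
  | base => exact continuous_const
  | step a φ _ ih => exact ih.matrix_vecMul (continuous_mat a)

theorem one_eq_det_smul_vecMul (A B : Matrix (Fin 1) (Fin 1) ℂ) (h : A * B = 1) :
    (fun _ => (1 : ℂ)) = A.det • ((fun _ => (1 : ℂ)) ᵥ* B) := by
  have h1 := congrFun (congrFun h 0) 0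
  simp only [Matrix.mul_apply, Fin.sum_univ_one, Matrix.one_apply_eq] at h1
  funext j
  rw [Subsingleton.elim j 0]
  simp [Matrix.vecMul, dotProduct, h1]

theorem IsPathFunctional.act {i : Option I} {φ : Rep Q (dimVec w) → Fin (dimVec w i) → ℂ}
    (h : IsPathFunctional Q w i φ) (g : Gauge (dimVec w)) (y : Rep Q (dimVec w)) :
    φ (FlowHecke.act g y) = (g none).val.det • (φ y ᵥ* (g i)⁻¹.val) := by
  induction h with
  | base =>
    exact one_eq_det_smul_vecMul (g none).val (g none)⁻¹.val (Units.mul_inv _)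
  | step a φ _ ih =>
    beta_reduce
    rw [ih, mat_act, Matrix.smul_vecMul, Matrix.vecMul_vecMul, Matrix.vecMul_vecMul,
      ← Matrix.mul_assoc, ← Matrix.mul_assoc]
    simp

/-- A complex function on a normed space grows at most like a power of `1 + ‖y‖`. -/
def PolyGrowth {V : Type*} [NormedAddCommGroup V] (f : V → ℂ) : Prop :=
  ∃ (C : ℝ) (n : ℕ), ∀ y, ‖f y‖ ≤ C * (1 + ‖y‖) ^ n

theorem PolyGrowth.const {V : Type*} [NormedAddCommGroup V] (c : ℂ) :
    PolyGrowth fun _ : V => c :=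
  ⟨‖c‖, 0, fun y => by simp⟩

theorem PolyGrowth.mul {V : Type*} [NormedAddCommGroup V] {f g : V → ℂ} (hf : PolyGrowth f)
    (hg : PolyGrowth g) : PolyGrowth fun y => f y * g y := by
  obtain ⟨C, n, hC⟩ := hf
  obtain ⟨D, m, hD⟩ := hg
  refine ⟨C * D, n + m, fun y => ?_⟩
  rw [norm_mul, pow_add, mul_mul_mul_comm]
  exact mul_le_mul (hC y) (hD y) (norm_nonneg _) ((norm_nonneg _).trans (hC y))

theorem PolyGrowth.add {V : Type*} [NormedAddCommGroup V] {f g : V → ℂ} (hf : PolyGrowth f)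
    (hg : PolyGrowth g) : PolyGrowth fun y => f y + g y := by
  obtain ⟨C, n, hC⟩ := hf
  obtain ⟨D, m, hD⟩ := hg
  refine ⟨|C| + |D|, n + m, fun y => (norm_add_le _ _).trans ?_⟩
  have h1 : (1 : ℝ) ≤ 1 + ‖y‖ := by linarith [norm_nonneg y]
  have h2 : (1 + ‖y‖) ^ n ≤ (1 + ‖y‖) ^ (n + m) := pow_le_pow_right₀ h1 (by omega)
  have h3 : (1 + ‖y‖) ^ m ≤ (1 + ‖y‖) ^ (n + m) := pow_le_pow_right₀ h1 (by omega)
  rw [add_mul]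
  refine add_le_add ((hC y).trans ?_) ((hD y).trans ?_)
  · exact mul_le_mul (le_abs_self C) h2 (by positivity) (abs_nonneg C)
  · exact mul_le_mul (le_abs_self D) h3 (by positivity) (abs_nonneg D)

theorem PolyGrowth.sum {V ι : Type*} [NormedAddCommGroup V] {f : ι → V → ℂ} (s : Finset ι)
    (hf : ∀ i, PolyGrowth (f i)) : PolyGrowth fun y => ∑ i ∈ s, f i y := by
  classical
  induction s using Finset.induction_on with
  | empty => simpa using PolyGrowth.const 0
  | insert i s hi ih => simpa only [Finset.sum_insert hi] using (hf i).add ih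

theorem PolyGrowth.prod {V ι : Type*} [NormedAddCommGroup V] {f : ι → V → ℂ} (s : Finset ι)
    (hf : ∀ i, PolyGrowth (f i)) : PolyGrowth fun y => ∏ i ∈ s, f i y := by
  classical
  induction s using Finset.induction_on with
  | empty => simpa using PolyGrowth.const 1
  | insert i s hi ih => simpa only [Finset.prod_insert hi] using (hf i).mul ih

theorem polyGrowth_mat (a : E) (i : Fin (dimVec w (Q.head a))) (j : Fin (dimVec w (Q.tail a))) :
    PolyGrowth fun y : Rep Q (dimVec w) => mat y a i j := by
  refine ⟨1, 1, fun y => ?_⟩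
  have := PiLp.norm_apply_le (p := 2) y ⟨a, (i, j)⟩
  simp only [mat, Matrix.of_apply, one_mul, pow_one]
  linarith

theorem IsPathFunctional.polyGrowth {i : Option I} {φ : Rep Q (dimVec w) → Fin (dimVec w i) → ℂ}
    (h : IsPathFunctional Q w i φ) (j : Fin (dimVec w i)) : PolyGrowth fun y => φ y j := by
  induction h with
  | base => exact PolyGrowth.const 1
  | step a φ _ ih => exact PolyGrowth.sum _ fun i => (ih i).mul (polyGrowth_mat a i j)

/-- On a costable representation the path functionals separate the vectors of `V_i`. -/
theorem IsCostable.exists_functionals {x : Rep Q (dimVec w)} (hx : IsCostable x) (i : Option I) :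
    ∃ φ : Fin (dimVec w i) → Rep Q (dimVec w) → Fin (dimVec w i) → ℂ,
      (∀ j, IsPathFunctional Q w i (φ j)) ∧ (Matrix.of fun j => φ j x).det ≠ 0 := by
  let S : ∀ i, Submodule ℂ (Fin (dimVec w i) → ℂ) := fun i =>
    { carrier := {m | ∀ φ, IsPathFunctional Q w i φ → φ x ⬝ᵥ m = 0}
      add_mem' := fun hm hm' φ hφ => by rw [dotProduct_add, hm φ hφ, hm' φ hφ, add_zero]
      zero_mem' := fun φ _ => dotProduct_zero _
      smul_mem' := fun c m hm φ hφ => by rw [dotProduct_smul, hm φ hφ, smul_zero] }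
  have hS : S i = ⊥ := by
    refine hx S ?_ ?_ i
    · refine (Submodule.eq_bot_iff _).2 fun m hm => ?_
      have h1 := hm _ IsPathFunctional.base
      funext j
      change ∑ l : Fin 1, (1 : ℂ) * m l = 0 at h1
      rw [Fin.sum_univ_one, one_mul] at h1
      rw [Subsingleton.elim (α := Fin 1) j 0]
      exact h1
    · intro a m hm φ hφ
      rw [Matrix.dotProduct_mulVec]
      exact hm _ (IsPathFunctional.step a φ hφ)
  let T : Set (Fin (dimVec w i) → ℂ) := {f | ∃ φ, IsPathFunctional Q w i φ ∧ φ x = f}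
  have hT : Submodule.span ℂ T = ⊤ := by
    by_contra hne
    obtain ⟨f, hf0, hf⟩ := Submodule.exists_le_ker_of_lt_top _ (lt_top_iff_ne_top.2 hne)
    have hfm : ∀ z : Fin (dimVec w i) → ℂ, f z = z ⬝ᵥ fun j => f (Pi.single j 1) := by
      intro z
      conv_lhs => rw [pi_eq_sum_univ' z]
      simp [dotProduct]
    have hm : (fun j => f (Pi.single j 1)) ∈ S i := by
      intro φ hφ
      rw [← hfm]
      exact hf (Submodule.subset_span ⟨φ, hφ, rfl⟩)
    rw [hS, Submodule.mem_bot] at hm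
    refine hf0 (LinearMap.ext fun z => ?_)
    rw [hfm, hm, dotProduct_zero, LinearMap.zero_apply]
  obtain ⟨b, hbT, hbs, hbi⟩ := exists_linearIndependent ℂ T
  have hb : ⊤ ≤ Submodule.span ℂ (Set.range ((↑) : b → Fin (dimVec w i) → ℂ)) := by
    rw [Subtype.range_coe, hbs, hT]
  let B := Module.Basis.mk hbi hb
  let e := B.indexEquiv (Pi.basisFun ℂ (Fin (dimVec w i)))
  choose φ hφ hφx using fun j : b => hbT j.2
  refine ⟨fun j => φ (e.symm j), fun j => hφ _, ?_⟩
  have h1 : LinearIndependent ℂ (Matrix.of fun j => φ (e.symm j) x).row := by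
    have h2 : (Matrix.of fun j => φ (e.symm j) x).row = Subtype.val ∘ e.symm := by
      funext j
      exact hφx _
    rw [h2]
    exact hbi.comp _ e.symm.injective
  exact ((Matrix.isUnit_iff_isUnit_det _).1
    (Matrix.linearIndependent_rows_iff_isUnit.1 h1)).ne_zero

/-- A costable representation is detected by equivariant frames `P_i` of path functionals, whose
determinants have polynomial growth. -/
theorem IsCostable.exists_frames {x : Rep Q (dimVec w)} (hx : IsCostable x) :
    ∃ P : ∀ i, Rep Q (dimVec w) → Matrix (Fin (dimVec w i)) (Fin (dimVec w i)) ℂ,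
      (∀ i, Continuous (P i)) ∧
      (∀ i g y, P i (FlowHecke.act g y) = (g none).val.det • (P i y * (g i)⁻¹.val)) ∧
      (∀ i, (P i x).det ≠ 0) ∧ PolyGrowth fun y => ∏ i, (P i y).det := by
  choose φ hφ hdet using hx.exists_functionals
  refine ⟨fun i y => Matrix.of fun j => φ i j y, fun i => ?_, fun i g y => ?_, hdet, ?_⟩
  · refine continuous_matrix fun j l => ?_
    exact (continuous_apply l).comp (hφ i j).continuous
  · refine Matrix.ext fun j l => ?_
    have := congrFun ((hφ i j).act g y) l
    exact this
  · refine PolyGrowth.prod _ fun i => ?_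
    simp only [Matrix.det_apply']
    exact PolyGrowth.sum _ fun σ => (PolyGrowth.const _).mul
      (PolyGrowth.prod _ fun j => (hφ i (σ j)).polyGrowth j)

end Costable
/-! ### Balanced points in the orbits of costable representations -/

section FirstVariation

variable {I E : Type*} [Fintype E] {Q : EdgeQuiver I E} {v : I → ℕ}

theorem hasDerivAt_det_one_add_smul {n : ℕ} (u : Matrix (Fin n) (Fin n) ℂ) :
    HasDerivAt (fun t : ℝ => (1 + (t : ℂ) • u).det) u.trace 0 := by
  refine hasDerivAt_add_smul (a := 1)
    (K := fun t : ℝ => u.trace +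
      (1 + (Polynomial.X : Polynomial ℂ) • u.map Polynomial.C).det.divX.divX.eval (t : ℂ) * t)
    (Filter.Eventually.of_forall fun t => ?_) ?_
  · rw [Matrix.det_one_add_smul, Complex.real_smul]
    ring
  · refine Continuous.tendsto' ?_ _ _ (by simp)
    fun_prop

theorem tendsto_inv_one_add_smul {n : ℕ} (u : Matrix (Fin n) (Fin n) ℂ) :
    Filter.Tendsto (fun t : ℝ => (1 + (t : ℂ) • u)⁻¹) (nhds 0) (nhds 1) := by
  have h0 : Continuous fun t : ℝ => 1 + (t : ℂ) • u := by fun_prop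
  have h1 : Filter.Tendsto (fun t : ℝ => ((1 + (t : ℂ) • u).det)⁻¹) (nhds 0) (nhds 1) := by
    have := (h0.matrix_det.tendsto' 0 1 (by simp)).inv₀ one_ne_zero
    simpa using this
  have h2 : Filter.Tendsto (fun t : ℝ => (1 + (t : ℂ) • u).adjugate) (nhds 0) (nhds 1) :=
    h0.matrix_adjugate.tendsto' 0 1 (by simp)
  simpa only [Matrix.inv_def, Ring.inverse_eq_inv', one_smul] using h1.smul h2

theorem eventually_det_ne_zero {n : ℕ} (u : Matrix (Fin n) (Fin n) ℂ) :
    ∀ᶠ t : ℝ in nhds 0, (1 + (t : ℂ) • u).det ≠ 0 := by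
  have h := (hasDerivAt_det_one_add_smul u).continuousAt
  exact h.eventually_ne (by simp)

theorem hasDerivAt_log_norm_det {n : ℕ} (u : Matrix (Fin n) (Fin n) ℂ) :
    HasDerivAt (fun t : ℝ => Real.log (‖(1 + (t : ℂ) • u).det‖ ^ 2)) (2 * u.trace.re) 0 := by
  have h := (hasDerivAt_det_one_add_smul u).norm_sq.log (by simp)
  convert h using 1
  simp [Complex.inner]

/-- The derivative of the action along the curve `t ↦ 1 + t u`, with values in the gauge group for
small `t`. -/
theorem hasDerivAt_sandwich_inv (y : Rep Q v) [Finite I]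
    (u : ∀ i : I, Matrix (Fin (v i)) (Fin (v i)) ℂ) :
    HasDerivAt (fun t : ℝ => sandwich (fun i => 1 + (t : ℂ) • u i)
      (fun i => (1 + (t : ℂ) • u i)⁻¹) y) (infAct y u) 0 := by
  refine hasDerivAt_add_smul (a := y)
    (K := fun t : ℝ => ofMat fun a =>
      u (Q.head a) * mat y a * (1 + (t : ℂ) • u (Q.tail a))⁻¹ -
        mat y a * u (Q.tail a) * (1 + (t : ℂ) • u (Q.tail a))⁻¹) ?_ ?_
  · have h : ∀ᶠ t : ℝ in nhds 0, ∀ i, (1 + (t : ℂ) • u i).det ≠ 0 :=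
      Filter.eventually_all.2 fun i => eventually_det_ne_zero (u i)
    filter_upwards [h] with t ht
    refine ext_mat fun a => ?_
    simp only [mat_sandwich, mat_add, mat_smul, mat_ofMat]
    have h1 : mat y a = mat y a * (1 + (t : ℂ) • u (Q.tail a))⁻¹ +
        t • (mat y a * u (Q.tail a) * (1 + (t : ℂ) • u (Q.tail a))⁻¹) := by
      conv_lhs => rw [← Matrix.mul_nonsing_inv_cancel_right _ (mat y a)
        (isUnit_iff_ne_zero.2 (ht (Q.tail a)))]
      rw [Matrix.mul_add, Matrix.mul_one, Matrix.mul_smul, Complex.coe_smul, Matrix.add_mul,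
        Matrix.smul_mul]
    calc (1 + (t : ℂ) • u (Q.head a)) * mat y a * (1 + (t : ℂ) • u (Q.tail a))⁻¹
        = mat y a * (1 + (t : ℂ) • u (Q.tail a))⁻¹ +
          t • (mat y a * u (Q.tail a) * (1 + (t : ℂ) • u (Q.tail a))⁻¹) +
          t • (u (Q.head a) * mat y a * (1 + (t : ℂ) • u (Q.tail a))⁻¹ -
            mat y a * u (Q.tail a) * (1 + (t : ℂ) • u (Q.tail a))⁻¹) := by
          rw [Matrix.add_mul, Matrix.one_mul, Complex.coe_smul, Matrix.smul_mul, Matrix.add_mul,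
            Matrix.smul_mul, smul_sub]
          abel
      _ = _ := by rw [← h1]
  · refine ((PiLp.continuous_toLp 2 _).tendsto _).comp ?_
    refine tendsto_pi_nhds.2 fun q => ?_
    have h : Continuous fun M : Matrix (Fin (v (Q.tail q.1))) (Fin (v (Q.tail q.1))) ℂ =>
        (u (Q.head q.1) * mat y q.1 * M - mat y q.1 * u (Q.tail q.1) * M) q.2.1 q.2.2 :=
      Continuous.matrix_elem (by fun_prop) _ _
    exact (h.tendsto' 1 _ (by rw [Matrix.mul_one, Matrix.mul_one])).comp
      (tendsto_inv_one_add_smul (u (Q.tail q.1)))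

end FirstVariation

section KempfNess

variable {I E : Type*} [Fintype E] {Q : EdgeQuiver (Option I) E} {w : I → ℕ}

/-- A function of polynomial growth is dominated by a Gaussian. -/
theorem PolyGrowth.tendsto_mul_exp {V : Type*} [NormedAddCommGroup V] [ProperSpace V] {f : V → ℂ}
    (hf : PolyGrowth f) {c : ℝ} (hc : 0 < c) :
    Filter.Tendsto (fun y => ‖f y‖ ^ 2 * Real.exp (-(c * ‖y‖ ^ 2))) (Filter.cocompact V)
      (nhds 0) := by
  obtain ⟨C, n, hC⟩ := hf
  have h1 : Filter.Tendsto (fun y : V => c * ‖y‖ ^ 2) (Filter.cocompact V) Filter.atTop :=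
    (((Filter.tendsto_pow_atTop two_ne_zero).comp
      (tendsto_norm_cocompact_atTop (E := V))).const_mul_atTop hc)
  have h2 := ((Real.tendsto_pow_mul_exp_neg_atTop_nhds_zero n).comp h1).const_mul
    (C ^ 2 * (4 / c) ^ n)
  rw [mul_zero] at h2
  refine squeeze_zero' (Filter.Eventually.of_forall fun y => by positivity) ?_ h2
  filter_upwards [(tendsto_norm_cocompact_atTop (E := V)).eventually_ge_atTop 1] with y hy
  simp only [Function.comp_apply]
  rw [← mul_assoc]
  refine mul_le_mul_of_nonneg_right ?_ (Real.exp_pos _).le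
  have h3 : (1 + ‖y‖) ^ n ≤ (2 * ‖y‖) ^ n := pow_le_pow_left₀ (by positivity) (by linarith) n
  calc ‖f y‖ ^ 2 ≤ (C * (1 + ‖y‖) ^ n) ^ 2 := pow_le_pow_left₀ (norm_nonneg _) (hC y) 2
    _ = C ^ 2 * ((1 + ‖y‖) ^ n) ^ 2 := by ring
    _ ≤ C ^ 2 * ((2 * ‖y‖) ^ n) ^ 2 := by gcongr
    _ = C ^ 2 * (4 / c) ^ n * (c * ‖y‖ ^ 2) ^ n := by
      have h4 : 4 / c * (c * ‖y‖ ^ 2) = (2 * ‖y‖) ^ 2 := by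
        field_simp
        ring
      rw [mul_assoc (C ^ 2), ← mul_pow (4 / c), h4, ← pow_mul, ← pow_mul, mul_comm n 2]

variable [Fintype I]

/-- If the frames `P_i` are invertible at a point `y` of the closure of the orbit of `x`, then `y`
lies in the orbit: the frames recover the group element. -/
theorem mem_orbit_of_mem_closure {x y : Rep Q (dimVec w)}
    {P : ∀ i, Rep Q (dimVec w) → Matrix (Fin (dimVec w i)) (Fin (dimVec w i)) ℂ}
    (hcont : ∀ i, Continuous (P i))
    (hact : ∀ i (g : Gauge (dimVec w)) y,
      P i (act g y) = (g none).val.det • (P i y * (g i)⁻¹.val))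
    (hx : ∀ i, (P i x).det ≠ 0) (hy : ∀ i, (P i y).det ≠ 0)
    (hcl : y ∈ closure (Set.range fun g : Gauge (dimVec w) => act g x)) :
    ∃ g : Gauge (dimVec w), act g x = y := by
  have hclosed : IsClosed {z : Rep Q (dimVec w) | ∀ a,
      (P (Q.head a) x)⁻¹ * P (Q.head a) z * mat z a =
        mat x a * ((P (Q.tail a) x)⁻¹ * P (Q.tail a) z)} := by
    simp only [Set.ofPred_forall]
    refine isClosed_iInter fun a => isClosed_eq ?_ ?_
    · exact (continuous_const.matrix_mul (hcont _)).matrix_mul (continuous_mat a)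
    · exact continuous_const.matrix_mul (continuous_const.matrix_mul (hcont _))
  have hsub : (Set.range fun g : Gauge (dimVec w) => act g x) ⊆ {z : Rep Q (dimVec w) | ∀ a,
      (P (Q.head a) x)⁻¹ * P (Q.head a) z * mat z a =
        mat x a * ((P (Q.tail a) x)⁻¹ * P (Q.tail a) z)} := by
    rintro _ ⟨g, rfl⟩ a
    have h1 : ∀ i, (P i x)⁻¹ * P i (act g x) = (g none).val.det • (g i)⁻¹.val := fun i => by
      rw [hact, Matrix.mul_smul,
        Matrix.nonsing_inv_mul_cancel_left _ _ (isUnit_iff_ne_zero.2 (hx i))]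
    rw [h1, h1, mat_act, Matrix.smul_mul, Matrix.mul_smul, ← Matrix.mul_assoc, ← Matrix.mul_assoc,
      Units.inv_mul, Matrix.one_mul]
  have hy2 := hclosed.closure_subset_iff.2 hsub hcl
  have hdet : ∀ i, IsUnit ((P i x)⁻¹ * P i y).det := fun i => by
    rw [Matrix.det_mul]
    exact ((Matrix.isUnit_nonsing_inv_det _ (isUnit_iff_ne_zero.2 (hx i))).mul
      (isUnit_iff_ne_zero.2 (hy i)))
  let h : Gauge (dimVec w) := fun i => Matrix.GeneralLinearGroup.mkOfDetNeZero _ (hdet i).ne_zero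
  refine ⟨h⁻¹, ?_⟩
  have h2 : act h y = x := by
    refine ext_mat fun a => ?_
    rw [mat_act]
    have : (h (Q.head a)).val * mat y a = mat x a * (h (Q.tail a)).val := hy2 a
    rw [this, Matrix.mul_assoc, Units.mul_inv, Matrix.mul_one]
  rw [← h2, ← act_mul, inv_mul_cancel, act_one]

/-- The product of the determinants of the frames is a semi-invariant for the inverse of the
character. -/
theorem prod_det_act
    {P : ∀ i, Rep Q (dimVec w) → Matrix (Fin (dimVec w i)) (Fin (dimVec w i)) ℂ}
    (hact : ∀ i (g : Gauge (dimVec w)) y,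
      P i (act g y) = (g none).val.det • (P i y * (g i)⁻¹.val))
    (g : Gauge (dimVec w)) (y : Rep Q (dimVec w)) :
    character (canonicalParam w) g * ∏ i, (P i (act g y)).det = ∏ i, (P i y).det := by
  have hg : ∀ i, (g i).val.det ≠ 0 := fun i =>
    ((Matrix.isUnit_iff_isUnit_det _).1 (g i).isUnit).ne_zero
  have h1 : ∀ i, (g i)⁻¹.val.det = ((g i).val.det)⁻¹ := fun i => by
    refine eq_inv_of_mul_eq_one_left ?_
    rw [← Matrix.det_mul, Units.inv_mul, Matrix.det_one]
  have h2 : ∀ i, (P i (act g y)).det =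
      (g none).val.det ^ dimVec w i * ((P i y).det * ((g i).val.det)⁻¹) := fun i => by
    rw [hact, Matrix.det_smul, Matrix.det_mul, h1, Fintype.card_fin]
  rw [character_canonicalParam]
  simp only [h2, Finset.prod_mul_distrib, Finset.prod_inv_distrib, Finset.prod_pow_eq_pow_sum]
  have h5 : ∑ i, dimVec w i = ∑ i, w i + 1 := by
    rw [Fintype.sum_option, add_comm]
    rfl
  rw [Fintype.prod_option (fun i => (g i).val.det), h5, pow_succ]
  have h3 : ∏ i : I, (g (some i)).val.det ≠ 0 := Finset.prod_ne_zero_iff.2 fun i _ => hg _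
  have h4 := hg none
  field_simp

variable [DecidableEq I]

theorem log_norm_character (α : Option I → ℤ) (g : Gauge (dimVec w)) :
    Real.log (‖character α g‖ ^ 2) = ∑ i, α i * Real.log (‖(g i).val.det‖ ^ 2) := by
  have hg : ∀ i, ‖(g i).val.det‖ ^ 2 ≠ 0 := fun i =>
    pow_ne_zero _ (norm_ne_zero_iff.2 ((Matrix.isUnit_iff_isUnit_det _).1 (g i).isUnit).ne_zero)
  rw [character, norm_prod, ← Finset.prod_pow, Real.log_prod]
  · refine Finset.sum_congr rfl fun i _ => ?_
    rw [norm_zpow, ← zpow_natCast, ← zpow_mul, mul_comm, zpow_mul, Real.log_zpow, zpow_natCast]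
  · intro i _
    exact pow_ne_zero _ (norm_ne_zero_iff.2 (zpow_ne_zero _ (by simpa using hg i)))

/-- The orbit of a costable representation meets every level of the real moment map that is a
positive multiple of the canonical parameter. -/
theorem IsCostable.exists_balanced {x : Rep Q (dimVec w)} (hx : IsCostable x) {c : ℝ}
    (hc : 0 < c) : ∃ g : Gauge (dimVec w), ∀ i,
      c • bracket (act g x) (act g x) i + (canonicalParam w i : ℂ) • (1 : Matrix _ _ ℂ) = 0 := by
  obtain ⟨P, hcont, hact, hPx, hgrow⟩ := hx.exists_frames
  set p : Rep Q (dimVec w) → ℂ := fun y => ∏ i, (P i y).det with hp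
  have hpcont : Continuous p := continuous_finsetProd _ fun i _ => (hcont i).matrix_det
  have hpx : p x ≠ 0 := Finset.prod_ne_zero_iff.2 fun i _ => hPx i
  set G : Rep Q (dimVec w) → ℝ := fun y => ‖p y‖ ^ 2 * Real.exp (-(c * ‖y‖ ^ 2)) with hG
  have hGcont : Continuous G := by fun_prop
  have hGx : 0 < G x := mul_pos (pow_pos (norm_pos_iff.2 hpx) 2) (Real.exp_pos _)
  have hmem : x ∈ closure (Set.range fun g : Gauge (dimVec w) => act g x) :=
    subset_closure ⟨1, act_one x⟩
  obtain ⟨y, hy, hmax⟩ := hGcont.continuousOn.exists_isMaxOn' isClosed_closure hmem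
    (Filter.Eventually.filter_mono inf_le_left
      (((hgrow.tendsto_mul_exp hc).eventually (gt_mem_nhds hGx)).mono fun z hz => hz.le))
  have hpy : p y ≠ 0 := by
    intro h0
    have h1 := hmax hmem
    have h2 : G y = 0 := by simp [hG, h0]
    simp only [Set.mem_ofPred_eq, h2] at h1
    linarith
  obtain ⟨g, rfl⟩ := mem_orbit_of_mem_closure hcont hact hPx
    (fun i => Finset.prod_ne_zero_iff.1 hpy i (Finset.mem_univ i)) hy
  refine ⟨g, ?_⟩
  set y := act g x with hyx
  -- in logarithmic form, maximality of `G` at `y` says that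
  -- `c ‖h y‖² + log |χ(h)|²` is minimal at `h = 1`
  have hmin : ∀ h : Gauge (dimVec w), c * ‖y‖ ^ 2 ≤
      c * ‖act h y‖ ^ 2 + ∑ i, canonicalParam w i * Real.log (‖(h i).val.det‖ ^ 2) := by
    intro h
    have h1 : G (act h y) ≤ G y := hmax (subset_closure ⟨h * g, act_mul h g x⟩)
    have hχ := character_ne_zero (canonicalParam w) h
    have h2 : character (canonicalParam w) h * p (act h y) = p y := prod_det_act hact h y
    have hph : p (act h y) ≠ 0 := fun h0 => hpy (by rw [← h2, h0, mul_zero])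
    have h3 : 0 < ‖p (act h y)‖ ^ 2 := pow_pos (norm_pos_iff.2 hph) 2
    have h4 : 0 < ‖character (canonicalParam w) h‖ ^ 2 := pow_pos (norm_pos_iff.2 hχ) 2
    have h5 : Real.exp (-(c * ‖act h y‖ ^ 2)) ≤
        ‖character (canonicalParam w) h‖ ^ 2 * Real.exp (-(c * ‖y‖ ^ 2)) := by
      simp only [hG] at h1
      rw [← h2, norm_mul, mul_pow] at h1
      refine le_of_mul_le_mul_left ?_ h3
      linarith
    rw [← log_norm_character]
    have h6 := Real.log_le_log (Real.exp_pos _) h5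
    rw [Real.log_mul h4.ne' (Real.exp_pos _).ne', Real.log_exp, Real.log_exp] at h6
    linarith
  have hfirst : ∀ u : ∀ i, Matrix (Fin (dimVec w i)) (Fin (dimVec w i)) ℂ,
      c * inner ℝ (infAct y u) y + ∑ i, canonicalParam w i * (u i).trace.re = 0 := by
    intro u
    -- along `h = 1 + t u` the inequality `hmin` gives a local minimum at `t = 0`
    have hd : HasDerivAt (fun t : ℝ => c * ‖sandwich (fun i => 1 + (t : ℂ) • u i)
        (fun i => (1 + (t : ℂ) • u i)⁻¹) y‖ ^ 2 +
          ∑ i, canonicalParam w i * Real.log (‖(1 + (t : ℂ) • u i).det‖ ^ 2))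
        (c * (2 * inner ℝ (sandwich (fun i => 1 + ((0 : ℝ) : ℂ) • u i)
        (fun i => (1 + ((0 : ℝ) : ℂ) • u i)⁻¹) y) (infAct y u)) +
          ∑ i, canonicalParam w i * (2 * (u i).trace.re)) 0 := by
      refine HasDerivAt.add ((hasDerivAt_sandwich_inv y u).norm_sq.const_mul c) ?_
      exact HasDerivAt.fun_sum fun i _ => (hasDerivAt_log_norm_det (u i)).const_mul _
    have hs0 : sandwich (fun i => 1 + ((0 : ℝ) : ℂ) • u i)
        (fun i => (1 + ((0 : ℝ) : ℂ) • u i)⁻¹) y = y := by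
      refine ext_mat fun a => ?_
      simp [mat_sandwich]
    have hloc : IsLocalMin (fun t : ℝ => c * ‖sandwich (fun i => 1 + (t : ℂ) • u i)
        (fun i => (1 + (t : ℂ) • u i)⁻¹) y‖ ^ 2 +
          ∑ i, canonicalParam w i * Real.log (‖(1 + (t : ℂ) • u i).det‖ ^ 2)) 0 := by
      have h : ∀ᶠ t : ℝ in nhds 0, ∀ i, (1 + (t : ℂ) • u i).det ≠ 0 :=
        Filter.eventually_all.2 fun i => eventually_det_ne_zero (u i)
      filter_upwards [h] with t ht
      have h1 := hmin fun i => Matrix.GeneralLinearGroup.mkOfDetNeZero _ (ht i)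
      have h2 : act (fun i => Matrix.GeneralLinearGroup.mkOfDetNeZero _ (ht i)) y =
          sandwich (fun i => 1 + (t : ℂ) • u i) (fun i => (1 + (t : ℂ) • u i)⁻¹) y := by
        refine ext_mat fun a => ?_
        rw [mat_act, mat_sandwich, Matrix.coe_units_inv]
        rfl
      rw [h2] at h1
      rw [hs0]
      simpa using h1
    have h0 := hloc.hasDerivAt_eq_zero hd
    rw [hs0, real_inner_comm] at h0
    simp only [mul_left_comm _ (2 : ℝ), ← Finset.mul_sum] at h0
    linarith
  have hzero := eq_zero_of_sum_trace_eq_zero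
    (Z := fun i => c • bracket y y i + (canonicalParam w i : ℂ) • (1 : Matrix _ _ ℂ)) (by
      have h1 := hfirst fun i => c • bracket y y i + (canonicalParam w i : ℂ) • (1 : Matrix _ _ ℂ)
      rw [inner_infAct, Finset.mul_sum, ← Finset.sum_add_distrib] at h1
      rw [← h1]
      refine Finset.sum_congr rfl fun i _ => ?_
      rw [Matrix.mul_add, Matrix.trace_add, Complex.add_re, Matrix.mul_smul, Matrix.mul_smul,
        Matrix.mul_one, Matrix.trace_smul, Matrix.trace_smul, Matrix.trace_conjTranspose]
      simp)
  exact fun i => congrFun hzero i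

end KempfNess
/-! ### Coordinate inclusions -/

section CoordinateInclusion

theorem coordIncl_transpose_mul_self {m n : ℕ} (h : m ≤ n) :
    (coordIncl m n)ᵀ * coordIncl m n = 1 := by
  ext i j
  rw [Matrix.mul_apply, Finset.sum_eq_single (Fin.castLE h i)]
  · simp [coordIncl, Matrix.one_apply, Fin.ext_iff]
  · intro l _ hl
    have : (l : ℕ) ≠ i := fun h0 => hl (Fin.ext h0)
    simp [coordIncl, this]
  · simp

theorem coordIncl_self (n : ℕ) : coordIncl n n = 1 := by
  ext i j
  simp [coordIncl, Matrix.one_apply, Fin.ext_iff]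

theorem coordIncl_conjTranspose (m n : ℕ) : (coordIncl m n)ᴴ = (coordIncl m n)ᵀ := by
  ext i j
  simp [coordIncl, Matrix.conjTranspose_apply, apply_ite]

/-- The orthogonal projection of `ℂⁿ` onto the first `m` coordinates. -/
def coordProj (m n : ℕ) : Matrix (Fin n) (Fin n) ℂ := coordIncl m n * (coordIncl m n)ᵀ

theorem coordProj_conjTranspose (m n : ℕ) : (coordProj m n)ᴴ = coordProj m n := by
  rw [coordProj, Matrix.conjTranspose_mul, ← coordIncl_conjTranspose,
    Matrix.conjTranspose_conjTranspose, coordIncl_conjTranspose]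

theorem coordProj_mul_coordIncl {m n : ℕ} (h : m ≤ n) :
    coordProj m n * coordIncl m n = coordIncl m n := by
  rw [coordProj, Matrix.mul_assoc, coordIncl_transpose_mul_self h, Matrix.mul_one]

theorem transpose_coordIncl_mul_coordProj {m n : ℕ} (h : m ≤ n) :
    (coordIncl m n)ᵀ * coordProj m n = (coordIncl m n)ᵀ := by
  rw [coordProj, ← Matrix.mul_assoc, coordIncl_transpose_mul_self h, Matrix.one_mul]

theorem coordProj_mul_self {m n : ℕ} (h : m ≤ n) :
    coordProj m n * coordProj m n = coordProj m n := by
  nth_rewrite 1 [coordProj]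
  rw [Matrix.mul_assoc, transpose_coordIncl_mul_coordProj h, coordProj]

theorem coordProj_of_eq {m n : ℕ} (h : m = n) : coordProj m n = 1 := by
  subst h
  rw [coordProj, coordIncl_self, Matrix.transpose_one, Matrix.one_mul]

/-- An injective matrix is the coordinate inclusion followed by an automorphism. -/
theorem exists_eq_mul_coordIncl {m n : ℕ} (h : m ≤ n) (A : Matrix (Fin n) (Fin m) ℂ)
    (hA : ∀ z, A *ᵥ z = 0 → z = 0) : ∃ g : GL (Fin n) ℂ, A = g.val * coordIncl m n := by
  have hA' : Function.Injective (Matrix.toLin' A) :=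
    (injective_iff_map_eq_zero _).2 fun z hz => hA z (by rwa [Matrix.toLin'_apply] at hz)
  have hJ' : Function.Injective (Matrix.toLin' (coordIncl m n)) := by
    refine (injective_iff_map_eq_zero _).2 fun z hz => ?_
    rw [Matrix.toLin'_apply] at hz
    have := congrArg (fun y => (coordIncl m n)ᵀ *ᵥ y) hz
    simpa [Matrix.mulVec_mulVec, coordIncl_transpose_mul_self h] using this
  let e := (LinearEquiv.ofInjective _ hJ').symm.trans (LinearEquiv.ofInjective _ hA')
  obtain ⟨f, hf⟩ := Submodule.exists_linearEquiv_restrict_eq e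
  have hfJ : ∀ z, f (Matrix.toLin' (coordIncl m n) z) = Matrix.toLin' A z := by
    intro z
    have h1 := hf (LinearEquiv.ofInjective _ hJ' z)
    simp only [e, LinearEquiv.trans_apply, LinearEquiv.symm_apply_apply,
      LinearEquiv.ofInjective_apply] at h1
    exact h1.symm
  refine ⟨⟨LinearMap.toMatrix' f.toLinearMap, LinearMap.toMatrix' f.symm.toLinearMap, ?_, ?_⟩, ?_⟩
  · rw [← LinearMap.toMatrix'_comp, LinearEquiv.comp_symm, LinearMap.toMatrix'_id]
  · rw [← LinearMap.toMatrix'_comp, LinearEquiv.symm_comp, LinearMap.toMatrix'_id]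
  · refine Matrix.toLin'.injective (LinearMap.ext fun z => ?_)
    rw [Matrix.toLin'_mul, Matrix.toLin'_toMatrix', LinearMap.comp_apply]
    exact (hfJ z).symm

variable {I E : Type*} [Fintype E] {Q : EdgeQuiver I E} {v₁ v : I → ℕ}

theorem mat_extendZero (x : Rep Q v₁) (a : E) :
    mat (extendZero v x) a = coordIncl (v₁ (Q.head a)) (v (Q.head a)) * mat x a *
      (coordIncl (v₁ (Q.tail a)) (v (Q.tail a)))ᵀ := rfl

theorem extendZero_self (x : Rep Q v) : extendZero v x = x := by
  refine ext_mat fun a => ?_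
  rw [mat_extendZero, coordIncl_self, coordIncl_self, Matrix.transpose_one, Matrix.one_mul,
    Matrix.mul_one]

theorem coordProj_mul_mat_extendZero (h : ∀ i, v₁ i ≤ v i) (x : Rep Q v₁) (a : E) :
    coordProj (v₁ (Q.head a)) (v (Q.head a)) * mat (extendZero v x) a = mat (extendZero v x) a := by
  rw [mat_extendZero, ← Matrix.mul_assoc, ← Matrix.mul_assoc, coordProj_mul_coordIncl (h _)]

theorem mat_extendZero_mul_coordProj (h : ∀ i, v₁ i ≤ v i) (x : Rep Q v₁) (a : E) :
    mat (extendZero v x) a * coordProj (v₁ (Q.tail a)) (v (Q.tail a)) = mat (extendZero v x) a := by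
  rw [mat_extendZero, Matrix.mul_assoc, transpose_coordIncl_mul_coordProj (h _)]

theorem mat_extendZero_mul_coordIncl (h : ∀ i, v₁ i ≤ v i) (x : Rep Q v₁) (a : E) :
    mat (extendZero v x) a * coordIncl (v₁ (Q.tail a)) (v (Q.tail a)) =
      coordIncl (v₁ (Q.head a)) (v (Q.head a)) * mat x a := by
  rw [mat_extendZero, Matrix.mul_assoc, coordIncl_transpose_mul_self (h _), Matrix.mul_one]

variable [Fintype I] [DecidableEq I]

/-- The coordinate inclusion of the total spaces. -/
def totalIncl (v₁ v : I → ℕ) : Matrix (Tot v) (Tot v₁) ℂ :=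
  Matrix.blockDiagonal' fun i => coordIncl (v₁ i) (v i)

theorem totalIncl_transpose_mul_self (h : ∀ i, v₁ i ≤ v i) :
    (totalIncl v₁ v)ᵀ * totalIncl v₁ v = 1 := by
  rw [totalIncl, Matrix.blockDiagonal'_transpose, ← Matrix.blockDiagonal'_mul,
    ← Matrix.blockDiagonal'_one]
  congr 1
  exact funext fun i => coordIncl_transpose_mul_self (h i)

theorem totalIncl_conjTranspose : (totalIncl v₁ v)ᴴ = (totalIncl v₁ v)ᵀ := by
  simp only [totalIncl, Matrix.blockDiagonal'_transpose, Matrix.blockDiagonal'_conjTranspose,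
    coordIncl_conjTranspose]

theorem toEnd_extendZero (x : Rep Q v₁) (a : E) :
    toEnd (extendZero v x) a = totalIncl v₁ v * toEnd x a * (totalIncl v₁ v)ᵀ := by
  simp only [toEnd, mat_extendZero, totalIncl, Matrix.blockDiagonal'_transpose]
  rw [Matrix.mul_assoc _ _ (Matrix.blockDiagonal' _), Matrix.mul_assoc _ _ (Matrix.blockDiagonal' _),
    blockIncl_transpose_mul, ← Matrix.mul_assoc (Matrix.blockDiagonal' _),
    ← Matrix.mul_assoc (Matrix.blockDiagonal' _), mul_blockIncl]
  simp only [Matrix.mul_assoc]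

theorem totalBracket_extendZero (h : ∀ i, v₁ i ≤ v i) (x y : Rep Q v₁) :
    totalBracket (extendZero v x) (extendZero v y) =
      totalIncl v₁ v * totalBracket x y * (totalIncl v₁ v)ᵀ := by
  rw [totalBracket, totalBracket, Matrix.mul_sum, Matrix.sum_mul]
  refine Finset.sum_congr rfl fun a _ => ?_
  simp only [toEnd_extendZero]
  rw [Matrix.conjTranspose_mul, Matrix.conjTranspose_mul, ← totalIncl_conjTranspose,
    Matrix.conjTranspose_conjTranspose, totalIncl_conjTranspose, Matrix.mul_sub, Matrix.sub_mul]
  have hc : ∀ M : Matrix (Tot v₁) (Tot v) ℂ, (totalIncl v₁ v)ᵀ * (totalIncl v₁ v * M) = M :=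
    fun M => by rw [← Matrix.mul_assoc, totalIncl_transpose_mul_self h, Matrix.one_mul]
  simp only [Matrix.mul_assoc, hc]

theorem bracket_extendZero (h : ∀ i, v₁ i ≤ v i) (x y : Rep Q v₁) (i : I) :
    bracket (extendZero v x) (extendZero v y) i =
      coordIncl (v₁ i) (v i) * bracket x y i * (coordIncl (v₁ i) (v i))ᵀ := by
  have h1 : Matrix.blockDiagonal' (bracket (extendZero v x) (extendZero v y)) =
      Matrix.blockDiagonal' fun i =>
        coordIncl (v₁ i) (v i) * bracket x y i * (coordIncl (v₁ i) (v i))ᵀ := by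
    rw [blockDiagonal'_bracket, totalBracket_extendZero h, ← blockDiagonal'_bracket, totalIncl,
      Matrix.blockDiagonal'_transpose, ← Matrix.blockDiagonal'_mul, ← Matrix.blockDiagonal'_mul]
  exact congrFun (Matrix.blockDiagonal'_injective h1) i

theorem complexMoment_extendZero {Q : EdgeQuiver I E} (h : ∀ i, v₁ i ≤ v i)
    (x : Rep Q.double v₁) : complexMoment (extendZero v x) =
      totalIncl v₁ v * complexMoment x * (totalIncl v₁ v)ᵀ := by
  rw [complexMoment, complexMoment, Matrix.mul_sum, Matrix.sum_mul]
  refine Finset.sum_congr rfl fun a _ => ?_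
  simp only [toEnd_extendZero]
  rw [Matrix.mul_sub, Matrix.sub_mul]
  have hc : ∀ M : Matrix (Tot v₁) (Tot v) ℂ, (totalIncl v₁ v)ᵀ * (totalIncl v₁ v * M) = M :=
    fun M => by rw [← Matrix.mul_assoc, totalIncl_transpose_mul_self h, Matrix.one_mul]
  simp only [Matrix.mul_assoc, hc]

theorem complexMoment_act {Q : EdgeQuiver I E} (g : Gauge v) (x : Rep Q.double v) :
    complexMoment (act g x) = Matrix.blockDiagonal' (fun i => (g i).val) * complexMoment x *
      Matrix.blockDiagonal' (fun i => (g i)⁻¹.val) := by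
  have h : ∀ a, toEnd (act g x) a = Matrix.blockDiagonal' (fun i => (g i).val) * toEnd x a *
      Matrix.blockDiagonal' (fun i => (g i)⁻¹.val) := fun a =>
    toEnd_sandwich (fun i => (g i).val) (fun i => (g i)⁻¹.val) x a
  have h1 : Matrix.blockDiagonal' (fun i => (g i)⁻¹.val) *
      Matrix.blockDiagonal' (fun i => (g i).val) = 1 := by
    rw [← Matrix.blockDiagonal'_mul, ← Matrix.blockDiagonal'_one]
    congr 1
    exact funext fun i => Units.inv_mul _
  have hc : ∀ M : Matrix (Tot v) (Tot v) ℂ, Matrix.blockDiagonal' (fun i => (g i)⁻¹.val) *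
      (Matrix.blockDiagonal' (fun i => (g i).val) * M) = M :=
    fun M => by rw [← Matrix.mul_assoc, h1, Matrix.one_mul]
  rw [complexMoment, complexMoment, Matrix.mul_sum, Matrix.sum_mul]
  refine Finset.sum_congr rfl fun a _ => ?_
  simp only [h]
  rw [Matrix.mul_sub, Matrix.sub_mul]
  simp only [Matrix.mul_assoc, hc]

/-- The infinitesimal stabilizer of a stable point consists of scalars. -/
theorem IsStable.exists_eq_smul_one {α : I → ℤ} {x : Rep Q v} (hx : IsStable α x)
    {u : ∀ i : I, Matrix (Fin (v i)) (Fin (v i)) ℂ} (hu : infAct x u = 0) :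
    ∃ c : ℂ, ∀ i, u i = c • 1 := by
  have h : ∀ᶠ t : ℝ in nhdsWithin 0 {0}ᶜ, t ≠ 0 ∧ ∀ i, (1 + (t : ℂ) • u i).det ≠ 0 := by
    filter_upwards [self_mem_nhdsWithin, nhdsWithin_le_nhds
      (Filter.eventually_all.2 fun i => eventually_det_ne_zero (u i))] with t ht ht'
    exact ⟨ht, ht'⟩
  obtain ⟨t, ht0, ht⟩ := h.exists
  -- `1 + t u` is invertible for small `t ≠ 0`, and it stabilizes `x`
  obtain ⟨c, hc⟩ := hx.2 (fun i => Matrix.GeneralLinearGroup.mkOfDetNeZero _ (ht i)) (by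
    refine ext_mat fun a => ?_
    have h1 : u (Q.head a) * mat x a - mat x a * u (Q.tail a) = 0 :=
      congrArg (fun z => mat z a) hu
    have h2 : (1 + (t : ℂ) • u (Q.head a)) * mat x a = mat x a * (1 + (t : ℂ) • u (Q.tail a)) := by
      rw [Matrix.add_mul, Matrix.mul_add, Matrix.one_mul, Matrix.mul_one, Matrix.smul_mul,
        Matrix.mul_smul, sub_eq_zero.1 h1]
    rw [mat_act]
    change (1 + (t : ℂ) • u (Q.head a)) * mat x a * _ = _
    rw [h2, Matrix.mul_assoc]
    change mat x a * ((Matrix.GeneralLinearGroup.mkOfDetNeZero _ (ht (Q.tail a))).val * _) = _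
    rw [Units.mul_inv, Matrix.mul_one])
  refine ⟨(t : ℂ)⁻¹ * (c - 1), fun i => ?_⟩
  have h1 : 1 + (t : ℂ) • u i = c • 1 := hc i
  have h2 : (t : ℂ) • u i = (c - 1) • 1 := by
    rw [sub_smul, one_smul, ← h1, add_sub_cancel_left]
  have h3 : (t : ℂ) ≠ 0 := by exact_mod_cast ht0
  rw [mul_smul, ← h2, smul_smul, inv_mul_cancel₀ h3, one_smul]

/-- If `H` is the scalar `h₁` on the support of `x` and `2 α_i = h₂` at the vertices where the
dimension grows, then `H` at `(x, 0)` is `h₁` on the support of `x` and `h₂` on its complement. -/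
theorem shiftedMoment_extendZero (h : ∀ i, v₁ i ≤ v i) {α : I → ℤ} {x : Rep Q v₁} {h₁ h₂ : ℝ}
    (hx : ∀ i, shiftedMoment α x i = (h₁ : ℂ) • 1)
    (hα : ∀ i, v₁ i = v i ∨ (2 * α i : ℂ) = h₂) (i : I) :
    shiftedMoment α (extendZero v x) i =
      h₁ • coordProj (v₁ i) (v i) + h₂ • (1 - coordProj (v₁ i) (v i)) := by
  have h1 : bracket x x i = (h₁ - 2 * α i : ℂ) • 1 := by
    rw [sub_smul, ← hx i, shiftedMoment, add_sub_cancel_right]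
  rw [shiftedMoment, bracket_extendZero h, h1, Matrix.mul_smul, Matrix.mul_one, Matrix.smul_mul,
    ← coordProj, ← Complex.coe_smul, ← Complex.coe_smul]
  rcases hα i with h2 | h2
  · rw [coordProj_of_eq h2]
    module
  · rw [h2]
    module

/-- Criticality of `(x, 0)`, restricted to the support of `x`. -/
theorem infAct_of_infAct_extendZero (h : ∀ i, v₁ i ≤ v i) {α : I → ℤ} {x : Rep Q v₁}
    (hx : infAct (extendZero v x) (shiftedMoment α (extendZero v x)) = 0) :
    infAct x (shiftedMoment α x) = 0 := by
  refine ext_mat fun a => ?_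
  have h1 : shiftedMoment α (extendZero v x) (Q.head a) * mat (extendZero v x) a -
      mat (extendZero v x) a * shiftedMoment α (extendZero v x) (Q.tail a) = 0 :=
    congrArg (fun z => mat z a) hx
  have h2 := congrArg (fun M => (coordIncl (v₁ (Q.head a)) (v (Q.head a)))ᵀ * M *
    coordIncl (v₁ (Q.tail a)) (v (Q.tail a))) h1
  have hc : ∀ i (M : Matrix (Fin (v₁ i)) (Fin (v₁ (Q.tail a))) ℂ),
      (coordIncl (v₁ i) (v i))ᵀ * (coordIncl (v₁ i) (v i) * M) = M :=
    fun i M => by rw [← Matrix.mul_assoc, coordIncl_transpose_mul_self (h i), Matrix.one_mul]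
  simp only [shiftedMoment, bracket_extendZero h, mat_extendZero, Matrix.add_mul, Matrix.mul_add,
    Matrix.sub_mul, Matrix.mul_sub, Matrix.smul_mul, Matrix.mul_smul, Matrix.one_mul,
    Matrix.mul_one, Matrix.mul_assoc, hc, coordIncl_transpose_mul_self (h _), Matrix.mul_zero,
    Matrix.zero_mul] at h2
  simp only [mat_infAct, shiftedMoment, Matrix.add_mul, Matrix.mul_add, Matrix.smul_mul,
    Matrix.mul_smul, Matrix.one_mul, Matrix.mul_one, mat_zero]
  exact h2

end CoordinateInclusion
/-! ### Flow lines and the Hecke correspondence -/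

section Comparison

/-- For a stable representation `x₁` of dimension `v₁` such that `(x₁, 0)` is critical, the matrix
`2i (μ - α)` is a negative scalar on the support of `x₁`: it is a scalar because it stabilizes `x₁`,
and its value follows by taking traces. -/
theorem exists_shiftedMoment_eq_neg {I E : Type*} [Fintype E] [Fintype I] [DecidableEq I]
    {Q : EdgeQuiver (Option I) E} {v₁ v : I → ℕ} (hlt : ∑ i, v₁ i < ∑ i, v i)
    {x : Rep Q (dimVec v₁)} (hx : IsStable (canonicalParam v₁) x)
    (h0 : infAct x (shiftedMoment (canonicalParam v) x) = 0) :
    ∃ h₁ : ℝ, h₁ < 0 ∧ ∀ i, shiftedMoment (canonicalParam v) x i = (h₁ : ℂ) • 1 := by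
  obtain ⟨c, hc⟩ := hx.exists_eq_smul_one h0
  have h1 : ∑ i, (shiftedMoment (canonicalParam v) x i).trace =
      2 * ((∑ i, v₁ i : ℕ) - (∑ i, v i : ℕ)) := by
    simp only [shiftedMoment, Matrix.trace_add, Finset.sum_add_distrib, sum_trace_bracket,
      Matrix.trace_smul, Matrix.trace_one, Fintype.card_fin, zero_add, smul_eq_mul]
    simp only [Fintype.sum_option, canonicalParam, dimVec]
    push_cast
    simp only [mul_one, ← Finset.mul_sum]
    ring
  have h2 : ∑ i, (shiftedMoment (canonicalParam v) x i).trace = c * ((∑ i, v₁ i : ℕ) + 1) := by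
    simp only [hc, Matrix.trace_smul, Matrix.trace_one, Fintype.card_fin, smul_eq_mul]
    simp only [Fintype.sum_option, dimVec]
    push_cast
    rw [← Finset.mul_sum]
    ring
  have hpos : (0 : ℝ) < (∑ i, v₁ i : ℕ) + 1 := by positivity
  have hpos' : ((∑ i, v₁ i : ℕ) + 1 : ℂ) ≠ 0 := by exact_mod_cast hpos.ne'
  refine ⟨2 * ((∑ i, v₁ i : ℕ) - (∑ i, v i : ℕ)) / ((∑ i, v₁ i : ℕ) + 1), ?_, fun i => ?_⟩
  · refine div_neg_of_neg_of_pos ?_ hpos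
    have : ((∑ i, v₁ i : ℕ) : ℝ) < (∑ i, v i : ℕ) := by exact_mod_cast hlt
    linarith
  · rw [hc]
    congr 1
    rw [h1] at h2
    push_cast at h2 hpos' ⊢
    rw [h2]
    field_simp

variable {I E : Type*} [Fintype I] [DecidableEq I] [Fintype E] (F : FramedQuiver I E)

theorem head_ne_tail (hloop : ∀ a, F.head a ≠ F.tail a) (a) :
    F.unframe.double.head a ≠ F.unframe.double.tail a := by
  rcases a with (a | b) | (a | b)
  · exact fun h => hloop a (Option.some_injective _ h)
  · exact fun h => Option.some_ne_none _ h
  · exact fun h => hloop a (Option.some_injective _ h).symm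
  · exact fun h => Option.some_ne_none _ h.symm

variable {F}

/-- The point `g · x` of the orbit of a stable point `x`. -/
def StablePoint.translate {v : I → ℕ} (x : StablePoint F v) (g : Gauge (dimVec v)) :
    StablePoint F v :=
  ⟨act g x.1, by rw [complexMoment_act, x.2.1, Matrix.mul_zero, Matrix.zero_mul],
    isStable_act x.2.2 g⟩

theorem StablePoint.mk_translate {v : I → ℕ} (x : StablePoint F v) (g : Gauge (dimVec v)) :
    Quotient.mk (orbitSetoid F v) (x.translate g) = Quotient.mk (orbitSetoid F v) x :=
  (Quotient.sound (⟨g, rfl⟩ : (orbitSetoid F v).r x (x.translate g))).symm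

section Dimension

variable {k : I} {v : I → ℕ}

theorem dimVec_sub_single_le (i : Option I) : dimVec (v - Pi.single k 1) i ≤ dimVec v i := by
  cases i with
  | none => exact le_rfl
  | some i => exact Nat.sub_le _ _

theorem dimVec_sub_single_eq {i : Option I} (hi : i ≠ some k) :
    dimVec (v - Pi.single k 1) i = dimVec v i := by
  cases i with
  | none => rfl
  | some i =>
    have : i ≠ k := fun h => hi (congrArg some h)
    simp [dimVec, this]

theorem sum_sub_single (hk : 0 < v k) : ∑ i, (v - Pi.single k 1 : I → ℕ) i + 1 = ∑ i, v i := by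
  have h1 : ∀ i, (v - Pi.single k 1 : I → ℕ) i + (Pi.single k 1 : I → ℕ) i = v i := by
    intro i
    by_cases h : i = k
    · subst h
      simp only [Pi.sub_apply, Pi.single_eq_same]
      omega
    · simp [h]
  rw [← Finset.sum_congr rfl fun i _ => h1 i, Finset.sum_add_distrib]
  simp

theorem eq_or_two_mul_canonicalParam (i : Option I) :
    dimVec (v - Pi.single k 1) i = dimVec v i ∨ (2 * canonicalParam v i : ℂ) = (2 : ℝ) := by
  by_cases hi : i = some k
  · right
    subst hi
    simp [canonicalParam]
  · exact Or.inl (dimVec_sub_single_eq hi)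

end Dimension

theorem exists_smul_eq_one (A B : Matrix (Fin 1) (Fin 1) ℂ) (h : A * B = 1) :
    ∃ d : ℂ, d • A = 1 := by
  refine ⟨B 0 0, ?_⟩
  have h1 := congrFun (congrFun h 0) 0
  rw [Matrix.mul_apply, Fin.sum_univ_one, mul_comm] at h1
  ext i j
  rw [Subsingleton.elim i 0, Subsingleton.elim j 0]
  exact h1

theorem flowModuli_subset_heckeCorrespondence {v : I → ℕ} {k : I} (hk : 0 < v k) :
    flowModuli F (v - Pi.single k 1) v ⊆ heckeCorrespondence F k v := by
  rintro _ ⟨x₁, x₂, rfl, ⟨_, hcrit, _⟩, _, δ, ⟨hneg, hslice, _⟩, g, hg⟩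
  refine ⟨x₁, x₂, rfl, ?_⟩
  have hle := dimVec_sub_single_le (k := k) (v := v)
  obtain ⟨h₁, hh₁, hx₁⟩ := exists_shiftedMoment_eq_neg
    (Nat.lt_of_succ_le (sum_sub_single hk).le) x₁.2.2
    (infAct_of_infAct_extendZero hle ((isCritical_iff _ _).1 hcrit))
  have hδ : ∀ a, mat δ a * coordIncl (dimVec (v - Pi.single k 1) (F.unframe.double.tail a))
      (dimVec v (F.unframe.double.tail a)) = 0 := by
    intro a
    rw [← coordProj_mul_coordIncl (hle _), ← Matrix.mul_assoc,
      mat_mul_eq_zero_of_mem_negEigenspace (h₁ := h₁) (h₂ := 2)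
        (p := fun i => coordProj (dimVec (v - Pi.single k 1) i) (dimVec v i))
        (fun i => coordProj_conjTranspose _ _) (fun i => coordProj_mul_self (hle i)) ?_
        (by linarith) (shiftedMoment_extendZero hle hx₁ eq_or_two_mul_canonicalParam) hslice hneg,
      Matrix.zero_mul]
    intro a
    rw [coordProj_mul_mat_extendZero hle, mat_extendZero_mul_coordProj hle]
  -- the component of `g` at `∞` is normalized to `1` by a scalar, which acts trivially
  obtain ⟨d, hd⟩ := exists_smul_eq_one (g none).val (g none)⁻¹.val (Units.mul_inv _)
  let ξ : HomZero (v - Pi.single k 1) v := fun i =>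
    d • ((g i).val * coordIncl (dimVec (v - Pi.single k 1) i) (dimVec v i))
  have hξ : ξ none = (1 : Matrix (Fin 1) (Fin 1) ℂ) := by
    have h1 : coordIncl (dimVec (v - Pi.single k 1) none) (dimVec v none) =
        (1 : Matrix (Fin 1) (Fin 1) ℂ) := coordIncl_self 1
    simp only [ξ, h1]
    exact (congrArg (d • ·) (Matrix.mul_one (n := Fin 1) _)).trans hd
  refine ⟨ξ, fun h0 => ?_, hξ, fun a => ?_⟩
  · rw [h0] at hξ
    exact one_ne_zero (α := Matrix (Fin 1) (Fin 1) ℂ) hξ.symm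
  · have h1 : mat x₂.1 a = (g (F.unframe.double.head a)).val *
        mat (extendZero (dimVec v) x₁.1 + δ) a * (g (F.unframe.double.tail a))⁻¹.val := by
      rw [← mat_act, hg]
    change d • (_ * _) * _ = _ * (d • (_ * _))
    rw [h1, Matrix.smul_mul, Matrix.mul_smul, Matrix.mul_assoc,
      ← mat_extendZero_mul_coordIncl hle, Matrix.mul_assoc, ← Matrix.mul_assoc (g _)⁻¹.val,
      Units.inv_mul, Matrix.one_mul, Matrix.mul_assoc, mat_add, Matrix.add_mul, hδ, add_zero]

/-- An intertwiner out of a costable representation which is the identity at `∞` is injective. -/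
theorem IsCostable.injective_of_intertwines {I E : Type*} [Fintype E]
    {Q : EdgeQuiver (Option I) E} {v₁ v : I → ℕ} {x₁ : Rep Q (dimVec v₁)}
    {x₂ : Rep Q (dimVec v)} (hx : IsCostable x₁)
    (ξ : ∀ i, Matrix (Fin (dimVec v i)) (Fin (dimVec v₁ i)) ℂ)
    (h0 : ξ none = (1 : Matrix (Fin 1) (Fin 1) ℂ))
    (hξ : ∀ a, ξ (Q.head a) * mat x₁ a = mat x₂ a * ξ (Q.tail a)) (i : Option I)
    (z : Fin (dimVec v₁ i) → ℂ) (hz : ξ i *ᵥ z = 0) : z = 0 := by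
  have h := hx (fun i => LinearMap.ker (ξ i).mulVecLin) ?_ ?_ i
  · have hz' : z ∈ LinearMap.ker (ξ i).mulVecLin := hz
    rwa [h, Submodule.mem_bot] at hz'
  · refine (Submodule.eq_bot_iff _).2 fun y hy => ?_
    have hy' : ξ none *ᵥ y = 0 := hy
    rw [h0] at hy'
    exact (Matrix.one_mulVec (m := Fin 1) y).symm.trans hy'
  · intro a y hy
    have hy' : ξ (Q.tail a) *ᵥ y = 0 := hy
    change ξ (Q.head a) *ᵥ (mat x₁ a *ᵥ y) = 0
    rw [Matrix.mulVec_mulVec, hξ, ← Matrix.mulVec_mulVec, hy', Matrix.mulVec_zero]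

/-- A representation of the form `x + b`, with `x` supported on the image of the projections `p` and
`b` mapping the kernel of `p` to its image, can be moved by a unipotent element of the gauge group so
that `b` becomes orthogonal to the orbit of `x`. -/
theorem exists_act_eq_add_of_block {I E : Type*} [Fintype I] [Fintype E] {Q : EdgeQuiver I E}
    {v : I → ℕ} {x b : Rep Q v} {p : ∀ i : I, Matrix (Fin (v i)) (Fin (v i)) ℂ}
    (hp : ∀ i, (p i)ᴴ = p i) (hpp : ∀ i, p i * p i = p i)
    (hpx : ∀ a, p (Q.head a) * mat x a = mat x a) (hxp : ∀ a, mat x a * p (Q.tail a) = mat x a)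
    (hpb : ∀ a, p (Q.head a) * mat b a = mat b a) (hbp : ∀ a, mat b a * p (Q.tail a) = 0) :
    ∃ (e : Gauge v) (δ : Rep Q v), act e (x + b) = x + δ ∧
      (∀ u : ∀ i : I, Matrix (Fin (v i)) (Fin (v i)) ℂ, inner ℝ (infAct x u) δ = 0) ∧
      (∀ a, p (Q.head a) * mat δ a = mat δ a) ∧ (∀ a, mat δ a * p (Q.tail a) = 0) := by
  let ρ : (∀ i : I, Matrix (Fin (v i)) (Fin (v i)) ℂ) →ₗ[ℝ] Rep Q v :=
    { toFun := infAct x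
      map_add' := infAct_add x
      map_smul' := infAct_smul x }
  obtain ⟨_, ⟨u, rfl⟩, l, hl, hb⟩ := (LinearMap.range ρ).exists_add_mem_mem_orthogonal b
  have hb' : b = infAct x u + l := hb
  have hlW : ∀ u : ∀ i : I, Matrix (Fin (v i)) (Fin (v i)) ℂ, inner ℝ (infAct x u) l = 0 :=
    fun u => (Submodule.mem_orthogonal _ _).1 hl _ ⟨u, rfl⟩
  obtain ⟨q, hq⟩ : ∃ q : ∀ i : I, Matrix (Fin (v i)) (Fin (v i)) ℂ, ∀ i, q i = 1 - p i :=
    ⟨_, fun _ => rfl⟩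
  have hqp : ∀ i, q i * p i = 0 := fun i => by simp [hq, Matrix.sub_mul, hpp]
  obtain ⟨s, hs⟩ : ∃ s : ∀ i : I, Matrix (Fin (v i)) (Fin (v i)) ℂ, ∀ i, s i = p i * u i * q i :=
    ⟨_, fun _ => rfl⟩
  have hss : ∀ i, s i * s i = 0 := fun i => by
    rw [hs, Matrix.mul_assoc, ← Matrix.mul_assoc (q i), ← Matrix.mul_assoc (q i), hqp, Matrix.zero_mul,
      Matrix.zero_mul, Matrix.mul_zero]
  let e : Gauge v := fun i => ⟨1 - s i, 1 + s i,
    by rw [Matrix.sub_mul, Matrix.mul_add, Matrix.mul_add, hss]; simp,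
    by rw [Matrix.add_mul, Matrix.mul_sub, Matrix.mul_sub, hss]; simp⟩
  have hsl : ∀ (a : E) (M : Matrix (Fin (v (Q.head a))) (Fin (v (Q.tail a))) ℂ),
      p (Q.head a) * M = M → s (Q.head a) * M = 0 := fun a M hM => by
    rw [← hM, hs, Matrix.mul_assoc, ← Matrix.mul_assoc (q _), hqp, Matrix.zero_mul, Matrix.mul_zero]
  have hbs : ∀ a, mat b a * s (Q.tail a) = 0 := fun a => by
    rw [hs, Matrix.mul_assoc, ← Matrix.mul_assoc (mat b a), hbp, Matrix.zero_mul]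
  have hδ : ∀ a, mat (sandwich p q l) a = mat b a + mat x a * s (Q.tail a) := fun a => by
    have h1 : mat l a = mat b a - (u (Q.head a) * mat x a - mat x a * u (Q.tail a)) := by
      rw [hb', mat_add, ← mat_infAct, add_sub_cancel_left]
    have h2 : mat x a * q (Q.tail a) = 0 := by simp [hq, Matrix.mul_sub, hxp]
    have h3 : mat b a * q (Q.tail a) = mat b a := by simp [hq, Matrix.mul_sub, hbp]
    rw [mat_sandwich, h1, Matrix.mul_sub, Matrix.mul_sub, hpb, Matrix.sub_mul, Matrix.sub_mul, h3]
    simp only [hs, Matrix.mul_assoc]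
    rw [h2, Matrix.mul_zero, Matrix.mul_zero, zero_sub, sub_neg_eq_add, ← Matrix.mul_assoc,
      ← Matrix.mul_assoc (mat x a) (p _), hpx, hxp]
  refine ⟨e, sandwich p q l, ?_, ?_, ?_, ?_⟩
  · refine ext_mat fun a => ?_
    rw [mat_act, mat_add, mat_add, hδ]
    change (1 - s (Q.head a)) * (mat x a + mat b a) * (1 + s (Q.tail a)) = _
    rw [Matrix.sub_mul, Matrix.mul_add (s _), hsl a _ (hpx a), hsl a _ (hpb a), Matrix.one_mul,
      add_zero, sub_zero, Matrix.mul_add, Matrix.mul_one, Matrix.add_mul, hbs, add_zero, add_assoc]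
  · refine inner_infAct_sandwich p q hp (fun i => ?_) (fun a => by rw [hpx, hxp]) (fun a => ?_) hlW
    · simp [hq, hp]
    · simp [hq, Matrix.sub_mul, Matrix.mul_sub, hpx, hxp]
  · intro a
    rw [mat_sandwich, ← Matrix.mul_assoc, ← Matrix.mul_assoc, hpp]
  · intro a
    rw [mat_sandwich, Matrix.mul_assoc, hqp, Matrix.mul_zero]

/-- A point balanced for the parameter `β` has scalar `H = shiftedMoment α x` at each vertex. -/
theorem shiftedMoment_of_balanced {I E : Type*} [Fintype I] [DecidableEq I] [Fintype E]
    {Q : EdgeQuiver I E} {v : I → ℕ} {α β : I → ℤ} {x : Rep Q v} {c : ℝ} (hc : 0 < c) {i : I}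
    (h : c • bracket x x i + (β i : ℂ) • (1 : Matrix _ _ ℂ) = 0) :
    shiftedMoment α x i = ((2 * α i - β i / c : ℝ) : ℂ) • 1 := by
  have h1 : bracket x x i = (-(β i / c) : ℂ) • 1 := by
    have hc' : (c : ℂ) ≠ 0 := by exact_mod_cast hc.ne'
    rw [← Complex.coe_smul, ← eq_neg_iff_add_eq_zero] at h
    rw [← inv_smul_smul₀ hc' (bracket x x i), h, smul_neg, smul_smul, ← neg_smul]
    congr 1
    field_simp
  rw [shiftedMoment, h1, ← add_smul]
  push_cast
  congr 1
  ring

theorem heckeCorrespondence_subset_flowModuli (hloop : ∀ a, F.head a ≠ F.tail a) {v : I → ℕ}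
    {k : I} (hk : 0 < v k) :
    heckeCorrespondence F k v ⊆ flowModuli F (v - Pi.single k 1) v := by
  rintro _ ⟨x₁, x₂, rfl, ξ, -, hξ0, hξ⟩
  have hle := dimVec_sub_single_le (k := k) (v := v)
  have hsum := sum_sub_single hk
  have hc₁ := isCostable_of_isSemistable x₁.2.2.1.1
  have hc₂ := isCostable_of_isSemistable x₂.2.2.1.1
  -- the constant `N / (2 (N + 1))`, for `N = ∑ v_i`, makes `(g₁ · x₁, 0)` critical
  have hN : (0 : ℝ) < (∑ i, v i : ℕ) := by
    rw [← hsum]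
    positivity
  obtain ⟨g₁, hg₁⟩ := hc₁.exists_balanced
    (c := (∑ i, v i : ℕ) / (2 * ((∑ i, v i : ℕ) + 1))) (by positivity)
  obtain ⟨g₂, hg₂⟩ := hc₂.exists_balanced (c := 1 / 2) (by norm_num)
  set y₁ := x₁.translate g₁ with hy₁
  set y₂ := x₂.translate g₂ with hy₂
  have hH₁ : ∀ i, shiftedMoment (canonicalParam v) y₁.1 i =
      ((-2 / (∑ i, v i : ℕ) : ℝ) : ℂ) • 1 := by
    intro i
    refine (shiftedMoment_of_balanced (by positivity) (hg₁ i)).trans ?_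
    congr 2
    have hsum' : ((∑ i, (v - Pi.single k 1 : I → ℕ) i : ℕ) : ℝ) + 1 = (∑ i, v i : ℕ) := by
      exact_mod_cast hsum
    cases i with
    | none =>
      have e1 : ((canonicalParam v none : ℤ) : ℝ) = -(∑ i, v i : ℕ) := by
        simp [canonicalParam]
      have e2 : ((canonicalParam (v - Pi.single k 1) none : ℤ) : ℝ) = 1 - (∑ i, v i : ℕ) := by
        rw [← hsum']
        simp only [canonicalParam]
        push_cast
        ring
      rw [e1, e2]
      field_simp
      ring
    | some i =>
      have e1 : ((canonicalParam v (some i) : ℤ) : ℝ) = 1 := by simp [canonicalParam]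
      have e2 : ((canonicalParam (v - Pi.single k 1) (some i) : ℤ) : ℝ) = 1 := by
        simp [canonicalParam]
      rw [e1, e2]
      field_simp
      ring
  have hH₂ : shiftedMoment (canonicalParam v) y₂.1 = 0 := by
    funext i
    refine (shiftedMoment_of_balanced (by norm_num) (hg₂ i)).trans ?_
    have h1 : (2 * canonicalParam v i - canonicalParam v i / (1 / 2) : ℝ) = 0 := by ring
    rw [h1, Complex.ofReal_zero, zero_smul]
    rfl
  -- the intertwiner extends to an automorphism `g`, and `g⁻¹ · y₂` is block triangular
  have hinj : ∀ i z, ((g₂ i).val * ξ i * (g₁ i)⁻¹.val) *ᵥ z = 0 → z = 0 := by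
    intro i z hz
    have h1 := congrArg (fun y => (g₂ i)⁻¹.val *ᵥ y) hz
    simp only [Matrix.mulVec_mulVec, Matrix.mulVec_zero] at h1
    rw [Matrix.mul_assoc, ← Matrix.mul_assoc, Units.inv_mul, Matrix.one_mul,
      ← Matrix.mulVec_mulVec] at h1
    have h2 := hc₁.injective_of_intertwines ξ hξ0 hξ i _ h1
    have h3 := congrArg (fun y => (g₁ i).val *ᵥ y) h2
    simpa only [Matrix.mulVec_mulVec, Matrix.mulVec_zero, Units.mul_inv, Matrix.one_mulVec] using h3
  choose g hg using fun i => exists_eq_mul_coordIncl (hle i) _ (hinj i)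
  have hz : ∀ a, mat (act g⁻¹ y₂.1) a *
      coordIncl (dimVec (v - Pi.single k 1) (F.unframe.double.tail a))
        (dimVec v (F.unframe.double.tail a)) =
      coordIncl (dimVec (v - Pi.single k 1) (F.unframe.double.head a))
        (dimVec v (F.unframe.double.head a)) * mat y₁.1 a := by
    intro a
    have e1 : mat y₂.1 a = (g₂ (F.unframe.double.head a)).val * mat x₂.1 a *
        (g₂ (F.unframe.double.tail a))⁻¹.val := mat_act _ _ _
    have e2 : mat y₁.1 a = (g₁ (F.unframe.double.head a)).val * mat x₁.1 a *
        (g₁ (F.unframe.double.tail a))⁻¹.val := mat_act _ _ _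
    have e3 : mat y₂.1 a * ((g (F.unframe.double.tail a)).val *
          coordIncl (dimVec (v - Pi.single k 1) (F.unframe.double.tail a))
            (dimVec v (F.unframe.double.tail a))) =
        (g (F.unframe.double.head a)).val *
          coordIncl (dimVec (v - Pi.single k 1) (F.unframe.double.head a))
            (dimVec v (F.unframe.double.head a)) * mat y₁.1 a := by
      rw [← hg, ← hg, e1, e2]
      simp only [Matrix.mul_assoc]
      rw [← Matrix.mul_assoc (g₂ (F.unframe.double.tail a))⁻¹.val, Units.inv_mul, Matrix.one_mul,
        ← Matrix.mul_assoc (g₁ (F.unframe.double.head a))⁻¹.val, Units.inv_mul, Matrix.one_mul,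
        ← Matrix.mul_assoc (mat x₂.1 a), ← hξ, Matrix.mul_assoc]
    rw [mat_act, Pi.inv_apply, Pi.inv_apply, inv_inv, Matrix.mul_assoc, Matrix.mul_assoc, e3,
      Matrix.mul_assoc, ← Matrix.mul_assoc _ (g _).val, Units.inv_mul, Matrix.one_mul]
  set x := extendZero (dimVec v) y₁.1 with hx
  let p : ∀ i, Matrix (Fin (dimVec v i)) (Fin (dimVec v i)) ℂ := fun i =>
    coordProj (dimVec (v - Pi.single k 1) i) (dimVec v i)
  have hpx : ∀ a, p (F.unframe.double.head a) * mat x a = mat x a :=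
    coordProj_mul_mat_extendZero hle _
  have hxp : ∀ a, mat x a * p (F.unframe.double.tail a) = mat x a :=
    mat_extendZero_mul_coordProj hle _
  have hbp : ∀ a, mat (act g⁻¹ y₂.1 - x) a * p (F.unframe.double.tail a) = 0 := fun a => by
    rw [mat_sub, Matrix.sub_mul, hxp]
    simp only [p, coordProj]
    rw [← Matrix.mul_assoc, hz, hx, mat_extendZero, sub_self]
  -- there are no loops, so at one end of each edge the projection is the identity
  have hpb : ∀ a, p (F.unframe.double.head a) * mat (act g⁻¹ y₂.1 - x) a =
      mat (act g⁻¹ y₂.1 - x) a := fun a => by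
    by_cases ha : F.unframe.double.head a = some k
    · have hta : F.unframe.double.tail a ≠ some k := fun h =>
        head_ne_tail F hloop a (ha.trans h.symm)
      have h1 := hbp a
      simp only [p] at h1
      rw [coordProj_of_eq (dimVec_sub_single_eq hta), Matrix.mul_one] at h1
      rw [h1, Matrix.mul_zero]
    · simp only [p]
      rw [coordProj_of_eq (dimVec_sub_single_eq ha), Matrix.one_mul]
  obtain ⟨e, δ, he, hW, hpδ, hδp⟩ := exists_act_eq_add_of_block (b := act g⁻¹ y₂.1 - x)
    (fun i => coordProj_conjTranspose _ _) (fun i => coordProj_mul_self (hle i)) hpx hxp hpb hbp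
  rw [add_sub_cancel, ← act_mul] at he
  have hHx := shiftedMoment_extendZero hle hH₁ eq_or_two_mul_canonicalParam
  refine ⟨y₁, y₂, Prod.ext (x₁.mk_translate g₁) (x₂.mk_translate g₂),
    ⟨?_, ?_, y₁.1, y₁.2.2, rfl⟩,
    ⟨y₂.2.1, ?_, y₂.1, y₂.2.2, (extendZero_self _).symm⟩, δ, ⟨?_, hW, ?_⟩, (e * g⁻¹)⁻¹, ?_⟩
  · rw [complexMoment_extendZero hle, y₁.2.1, Matrix.mul_zero, Matrix.zero_mul]
  · rw [isCritical_iff]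
    refine ext_mat fun a => ?_
    rw [mat_infAct, hHx, hHx, Matrix.add_mul, Matrix.mul_add, Matrix.smul_mul, Matrix.smul_mul,
      Matrix.mul_smul, Matrix.mul_smul, Matrix.sub_mul, Matrix.mul_sub, Matrix.one_mul,
      Matrix.mul_one]
    change _ • (p _ * mat x a) + _ • (mat x a - p _ * mat x a) -
      (_ • (mat x a * p _) + _ • (mat x a - mat x a * p _)) = _
    rw [hpx, hxp, sub_self]
    rfl
  · rw [isCritical_iff, hH₂]
    refine ext_mat fun a => ?_
    simp [mat_infAct, mat_zero]
  · refine mem_negEigenspace (p := p) (h₂ := 2) ?_ hHx hW hpδ hδp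
    have : -2 / ((∑ i, v i : ℕ) : ℝ) < 0 := div_neg_of_neg_of_pos (by norm_num) hN
    linarith
  · rw [← hx, ← he, complexMoment_act, y₂.2.1, Matrix.mul_zero, Matrix.zero_mul]
  · change act (e * g⁻¹)⁻¹ (x + δ) = y₂.1
    rw [← he, ← act_mul, inv_mul_cancel, act_one]

end Comparison
end FlowHecke

end

theorem theorem4p2 {I E : Type*} [Fintype I] [DecidableEq I] [Fintype E]
    (F : FlowHecke.FramedQuiver I E) (hloop : ∀ a, F.head a ≠ F.tail a)
    (v : I → ℕ) (k : I) (hk : 0 < v k) :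
    ∃ φ : FlowHecke.flowModuli F (v - Pi.single k 1) v ≃ₜ FlowHecke.heckeCorrespondence F k v,
      ∀ p, (φ p : FlowHecke.QuiverVariety F (v - Pi.single k 1) × FlowHecke.QuiverVariety F v) = p :=
  ⟨Homeomorph.setCongr (Set.Subset.antisymm (FlowHecke.flowModuli_subset_heckeCorrespondence hk)
    (FlowHecke.heckeCorrespondence_subset_flowModuli hloop hk)), fun _ => rfl⟩
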